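/- **Problem.** Let $f_0:\mathbb R^d\to\mathbb R$ be differentiable with $L_f$-Lipschitz gradient ($L_f>0$), let $\bar g:\mathbb R^{\bar n}\to\mathbb R$ be convex, $A\in\mathbb R^{n\times d}$, $b\in\mathbb R^n$, $\bar A\in\mathbb R^{\bar n\times d}$, $\bar b\in\mathbb R^{\bar n}$, $g(x)=\bar g(\bar Ax+\bar b)$, $F_0=f_0+g$, and consider $$\text{(P)}\qquad \min_x F_0(x)\quad\text{s.t. } Ax+b=0 .$$ Assume that $\inf F_0>-\infty$ and $\inf_{x,y}\,(f_0(x)+\bar g(y))>-\infty$, that $f_0$ is $l_f$-Lipschitz and $\bar g$ is $l_g$-Lipschitz on the whole space ($l_g>0$), and that $A$ has full row rank. Let $M=[\bar A;A]\ne0$ be the stacked matrix, let $\lambda_{\max},\lambda_{\min}$ be the largest and the smallest positive eigenvalue of $MM^\top$, and $\kappa(M)=\sqrt{\lambda_{\max}/\lambda_{\min}}$. A point $x^*$ is an $\epsilon$-stationary point of (P) if for some $\gamma$, $\max\{\mathrm{dist}(0,\nabla f_0(x^*)+A^\top\gamma+\partial g(x^*)),\ \|Ax^*+b\|\}\le\epsilon$.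 **Method (IPG with restarted APG).** Input: $\sigma>0$ and $x^{(0)}$ with $Ax^{(0)}+b=0$, $y^{(0)}=\bar Ax^{(0)}+\bar b$, such that $\Delta_{F_0}=F_0(x^{(0)})-\inf F_0>0$. Let $\tau=2L_f$, $p=\|(AA^\top)^{-1}A\|$ and $B_1=\frac1\tau\|\bar A\|\|M\|+\sigma^{-1}+\frac1\tau(\|\bar A\|+\|A\|)\|M\|$, $B_2=p(l_f+\|\bar A\|l_g)$, $B_3=1+p\|M\|$, $B_4=\frac1\tau(l_f+\|M\|(l_g+B_2))$, $$\bar\delta_\epsilon=\min\Big\{\tfrac{\epsilon}{6\|M\|},\tfrac{\Delta_{F_0}}{B_1l_g},\tfrac{\epsilon}{B_1\sigma},\tfrac{\epsilon}{B_1},\tfrac{\epsilon^2}{48L_fB_1(B_2+\sigma\|\bar A\|B_4+l_g)},\sqrt{\tfrac{\epsilon^2}{48L_fB_1B_3(1+\frac1\tau\sigma\|\bar A\|\|M\|)}}\Big\},\qquad \bar K_\epsilon=\lceil192L_f\Delta_{F_0}\epsilon^{-2}\rceil .$$ For $k\ge0$ put $\mathcal D_k(z)=\frac1{2\tau}\|M^\top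 z+\nabla f_0(x^{(k)})-\tau x^{(k)}\|^2+\bar g^\star(z_1)-z_1^\top\bar b-z_2^\top b$ for $z=(z_1,z_2)$, with minimum $\mathcal D_k^*$ and set of minimizers $\Omega^{(k+1)}$. With $\delta=\bar\delta_\epsilon$, a point $z^{(k+1)}$ is computed that should satisfy $$(\ast)\qquad z_1^{(k+1)}\in\mathrm{dom}\,\bar g^\star,\qquad \mathrm{dist}(z^{(k+1)},\Omega^{(k+1)})\le\delta,$$ and then $x^{(k+1)}=x^{(k)}-\frac1\tau(M^\top z^{(k+1)}+\nabla f_0(x^{(k)}))$ and $y^{(k+1)}=\mathrm{prox}_{\sigma^{-1}\bar g}(\sigma^{-1}z_1^{(k+1)}+\bar Ax^{(k+1)}+\bar b)$. The point $z^{(k+1)}$ is the output of $i_k$ consecutive loops of $j_k$ steps of the accelerated proximal gradient method (FISTA with step $1/L_{\mathcal D}$, $L_{\mathcal D}=\lambda_{\max}/\tau$, and $\alpha_{j+1}=(1+\sqrt{1+4\alpha_j^2})/2$), restarted ($\alpha_0=1$, no extrapolation) at the beginning of each loop, and started at $z^{\rm ini}=(y^{(0)},Ax^{(0)})$. Here,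 for a number $\rho_k>0$ specified below, $j_k=\lceil2\sqrt{2L_{\mathcal D}/\rho_k}\rceil$ and $i_k=\max\{0,\lceil\log_2(2(\mathcal D_k(z^{\rm ini})-\mathcal D_k^*)/(\rho_k\delta^2))\rceil\}$ (read as $0$ if $\mathcal D_k(z^{\rm ini})=\mathcal D_k^*$); if $\mathcal D_k(z^{\rm ini})=+\infty$, then $i_k$ is the least number of loops after which $(\ast)$ holds. Let $\nu^{(k)}$ denote the common value of $\frac1\tau(M^\top z+\nabla f_0(x^{(k)})-\tau x^{(k)})$ over $z\in\Omega^{(k+1)}$. In the *polyhedral case*, i.e. $\bar g(y)=\max\{u^\top y: Cu\le c\}$ for all $y$, for some $C,c$, the set $\Omega^{(k+1)}$ is described by the linear system $$M^\top z=\tau\nu^{(k)}-\nabla f_0(x^{(k)})+\tau x^{(k)},\qquad -z_1^\top\bar b-z_2^\top b=\mathcal D_k^*-\tfrac\tau2\|\nu^{(k)}\|^2,\qquad Cz_1\le c,$$ and $\theta=\theta(\bar A,A,\bar b,b,C)$ denotes a Hoffman constant of it: the distance of any $z$ to the solution set is at most $\theta$ times the norm of the residual of the system, whatever the point that stands in place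 of $x^{(k)}$. If $\bar b=0$ and $b=0$, the second equation is dropped and the constant is denoted by $\theta(\bar A,A,C)$. **Claim.** There is an absolute constant $c_0$ such that the following holds for all such problems. In each of the cases (a)–(c), for every $\epsilon>0$, all $z^{(k+1)}$ satisfy $(\ast)$, and if $k'\in\{0,\dots,\bar K_\epsilon-1\}$ minimizes $\|x^{(k+1)}-x^{(k)}\|$ over $0\le k<\bar K_\epsilon$, then $x^{(k'+1)}$ is $\frac{\epsilon}{12L_f}$-close to an $\epsilon$-stationary point of (P). Moreover, the total number $\sum_{k<\bar K_\epsilon}i_kj_k$ of APG steps (inner iterations) is bounded as follows for all sufficiently small $\epsilon>0$; how small may depend on the problem data, $\sigma$, $x^{(0)}$, $C$, $c$, $\theta$ and, in (c), on $B_5,B_6$. (a) If $M$ has full row rank and $\rho_k=\lambda_{\min}/\tau$ (so that $j_k=\lceil2\sqrt2\,\kappa(M)\rceil$), by $$c_0\;\kappa(M)\,\log\Big(\frac{\Delta_{F_0}}{\epsilon}\Big)\frac{L_f\Delta_{F_0}}{\epsilon^2}.$$ (b) In the polyhedral case with $\bar b=0$, $b=0$, $\theta=\theta(\bar A,A,C)$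 and $\rho_k=(\theta^2\tau)^{-1}$, by $$c_0\,\sqrt{\lambda_{\max}\theta^2}\,\log\Big(\frac{\Delta_{F_0}}{\epsilon}\Big)\frac{L_f\Delta_{F_0}}{\epsilon^2}.$$ (c) In the polyhedral case with $y^{(0)}\in\mathrm{dom}\,\bar g^\star$, $\theta=\theta(\bar A,A,\bar b,b,C)$ and $\rho_k=(\theta^2(\tau+\mathcal D_k(z^{\rm ini})-\mathcal D_k^*+2\tau\|\nu^{(k)}\|^2))^{-1}$ (respectively $\rho_k=(\theta^2\tau)^{-1}$ if $\bar b=0$ and $b=0$): for every $R$ there are constants $B_5$ and $B_6>0$, independent of $\epsilon$, such that $\|\nu^{(k)}\|^2\le B_5$ and $\mathcal D_k(z^{\rm ini})-\mathcal D_k^*\le B_6$ for all $k\ge0$ whenever the sequence $\{x^{(k)}\}$ is bounded by $R$; and for any $B_5$ and $B_6>0$ independent of $\epsilon$, the total number is bounded, for those $\epsilon$ for which these two inequalities hold for all $k\ge 0$, by $$c_0\,\max\Big\{1,\sqrt{\lambda_{\max}\theta^2\,(1+B_6/\tau+2B_5)}\Big\}\log\Big(\frac{B_6}{\epsilon}\Big)\frac{L_f\Delta_{F_0}}{\epsilon^2}.$$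 -/

import Mathlib

open scoped ENNReal RealInnerProductSpace

noncomputable section

namespace IPG

/-- Euclidean space with coordinates indexed by `ι`. -/
abbrev Vec (ι : Type) := EuclideanSpace ℝ ι

section General

variable {ι κ : Type} [Fintype ι] [Fintype κ] [DecidableEq ι] [DecidableEq κ]

/-- The matrix `A` as a continuous linear map between Euclidean spaces; its norm is the spectral
norm of `A`. -/
def lin (A : Matrix ι κ ℝ) : Vec κ →L[ℝ] Vec ι :=
  LinearMap.toContinuousLinearMap (Matrix.toEuclideanLin A)

/-- Largest eigenvalue of `A Aᵀ`. -/
def lamMax (A : Matrix ι κ ℝ) : ℝ :=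
  sSup {l : ℝ | Module.End.HasEigenvalue (Matrix.toLin' (A * A.transpose)) l}

/-- Smallest positive eigenvalue of `A Aᵀ`. -/
def lamMin (A : Matrix ι κ ℝ) : ℝ :=
  sInf {l : ℝ | 0 < l ∧ Module.End.HasEigenvalue (Matrix.toLin' (A * A.transpose)) l}

/-- Condition number of `A`. -/
def condNumber (A : Matrix ι κ ℝ) : ℝ := Real.sqrt (lamMax A / lamMin A)

/-- The stacked vector `(z₁, z₂)`. -/
def stack (z₁ : Vec ι) (z₂ : Vec κ) : Vec (ι ⊕ κ) :=
  WithLp.toLp 2 (Sum.elim (fun i => z₁ i) (fun i => z₂ i))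

/-- First block of a stacked vector. -/
def fstBlock (z : Vec (ι ⊕ κ)) : Vec ι := WithLp.toLp 2 (fun i => z (Sum.inl i))

/-- Second block of a stacked vector. -/
def sndBlock (z : Vec (ι ⊕ κ)) : Vec κ := WithLp.toLp 2 (fun i => z (Sum.inr i))

/-- The convex conjugate `h⋆(z) = sup_y (⟨y, z⟩ - h y)`, with values in the extended reals. -/
def conj (h : Vec ι → ℝ) (z : Vec ι) : EReal := ⨆ y : Vec ι, ((⟪y, z⟫ - h y : ℝ) : EReal)

/-- `u` minimizes `h u + ‖u - v‖² / (2η)`. -/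
def IsProx (h : Vec ι → EReal) (η : ℝ) (v u : Vec ι) : Prop :=
  ∀ w : Vec ι, h u + ((1 / (2 * η) * ‖u - v‖ ^ 2 : ℝ) : EReal) ≤
    h w + ((1 / (2 * η) * ‖w - v‖ ^ 2 : ℝ) : EReal)

/-- The proximal mapping `prox_{η h}`. -/
def prox (h : Vec ι → EReal) (η : ℝ) (v : Vec ι) : Vec ι :=
  Classical.epsilon (IsProx h η v)

/-- The subdifferential of a finite convex function. -/
def subdiff (h : Vec ι → ℝ) (x : Vec ι) : Set (Vec ι) :=
  {v | ∀ x' : Vec ι, h x + ⟪v, x' - x⟫ ≤ h x'}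

end General

/-- The data of the problem `min f₀(x) + ḡ(Ā x + b̄)` subject to `A x + b = 0`, together with the
constants `L_f`, `l_f`, `l_g` and the inputs `σ`, `x⁽⁰⁾` of the method. No property is assumed
here. The function `ḡ` is taken real-valued, since it is going to be Lipschitz continuous on the
whole space, which forces a proper extended-valued function to be finite everywhere. -/
structure Setup (d n nb : ℕ) where
  A : Matrix (Fin n) (Fin d) ℝ
  b : Vec (Fin n)
  Abar : Matrix (Fin nb) (Fin d) ℝ
  bbar : Vec (Fin nb)
  f0 : Vec (Fin d) → ℝ
  gbar : Vec (Fin nb) → ℝ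
  Lf : ℝ
  lf : ℝ
  lg : ℝ
  sigma : ℝ
  x0 : Vec (Fin d)

namespace Setup

variable {d n nb : ℕ} (S : Setup d n nb)

/-- `g(x) = ḡ(Ā x + b̄)`. -/
def g (x : Vec (Fin d)) : ℝ := S.gbar (lin S.Abar x + S.bbar)

/-- `F₀ = f₀ + g`. -/
def F0 (x : Vec (Fin d)) : ℝ := S.f0 x + S.g x

/-- `F(x, y) = f₀(x) + ḡ(y)`, the objective of the splitting problem. -/
def F (p : Vec (Fin d) × Vec (Fin nb)) : ℝ := S.f0 p.1 + S.gbar p.2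

/-- `Δ_{F₀} = F₀(x⁽⁰⁾) - inf F₀`. -/
def Delta : ℝ := S.F0 S.x0 - ⨅ x, S.F0 x

/-- The stacked matrix `[Ā; A]`. -/
def M : Matrix (Fin nb ⊕ Fin n) (Fin d) ℝ := Matrix.fromRows S.Abar S.A

/-- Standing assumptions on the problem: smooth part, lower boundedness, convexity. -/
structure ProblemAssumptions : Prop where
  Lf_pos : 0 < S.Lf
  differentiable : Differentiable ℝ S.f0
  gradient_lipschitz : ∀ x x', ‖gradient S.f0 x - gradient S.f0 x'‖ ≤ S.Lf * ‖x - x'‖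
  F0_bddBelow : BddBelow (Set.range S.F0)
  gbar_convex : ConvexOn ℝ Set.univ S.gbar

/-- Additional assumptions: `F` bounded below, `f₀` and `ḡ` Lipschitz, `A` of full row rank.
As `ḡ` is finite everywhere, the relative interior of its domain is the whole space, and a feasible
point is supplied by the starting point of the method, see `InputAssumptions`. -/
structure LipschitzAssumptions : Prop where
  F_bddBelow : BddBelow (Set.range S.F)
  f0_lipschitz : ∀ x x', |S.f0 x - S.f0 x'| ≤ S.lf * ‖x - x'‖
  lg_pos : 0 < S.lg
  gbar_lipschitz : ∀ y y', |S.gbar y - S.gbar y'| ≤ S.lg * ‖y - y'‖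
  A_fullRowRank : LinearIndependent ℝ S.A.row

/-- The inputs of the method: `σ > 0` and a feasible start (`y⁽⁰⁾ = Ā x⁽⁰⁾ + b̄` is determined). -/
structure InputAssumptions : Prop where
  sigma_pos : 0 < S.sigma
  feasible : lin S.A S.x0 + S.b = 0

/-- `[Ā; A]` has full row rank. -/
def StackedFullRowRank : Prop := LinearIndependent ℝ S.M.row

/-- `ḡ(y) = max {uᵀ y : C u ≤ c}`, the maximum being attained. -/
def Polyhedral {m : ℕ} (C : Matrix (Fin m) (Fin nb) ℝ) (c : Vec (Fin m)) : Prop :=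
  ∀ y, IsGreatest {r : ℝ | ∃ u : Vec (Fin nb), (∀ i, lin C u i ≤ c i) ∧ r = ⟪u, y⟫} (S.gbar y)

/-- `x` is an `ε`-stationary point of `min F₀(x)` subject to `A x + b = 0`. -/
def IsStationary (ε : ℝ) (x : Vec (Fin d)) : Prop :=
  ∃ γ : Vec (Fin n),
    Metric.infEDist 0 ((fun v => gradient S.f0 x + lin S.A.transpose γ + v) '' subdiff S.g x)
        ≤ ENNReal.ofReal ε ∧
      ‖lin S.A x + S.b‖ ≤ ε

/-! ### Parameters of the method -/

/-- `τ = 2 L_f`. -/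
def tau : ℝ := 2 * S.Lf

def B1 : ℝ :=
  1 / S.tau * ‖lin S.Abar‖ * ‖lin S.M‖ + S.sigma⁻¹
    + 1 / S.tau * (‖lin S.Abar‖ + ‖lin S.A‖) * ‖lin S.M‖

/-- `‖(A Aᵀ)⁻¹ A‖`. -/
def pinvNorm : ℝ := ‖lin ((S.A * S.A.transpose)⁻¹ * S.A)‖

def B2 : ℝ := S.pinvNorm * (S.lf + ‖lin S.Abar‖ * S.lg)

def B3 : ℝ := 1 + S.pinvNorm * ‖lin S.M‖

def B4 : ℝ := 1 / S.tau * (S.lf + ‖lin S.M‖ * (S.lg + S.B2))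

/-- The tolerance `δ_ε`. -/
def delta (ε : ℝ) : ℝ :=
  min (min (ε / (S.B1 * S.sigma)) (ε / S.B1))
    (min (ε ^ 2 / (48 * S.Lf * S.B1 * (S.B2 + S.sigma * ‖lin S.Abar‖ * S.B4 + S.lg)))
      (Real.sqrt (ε ^ 2 /
        (48 * S.Lf * S.B1 * S.B3 * (1 + 1 / S.tau * S.sigma * ‖lin S.Abar‖ * ‖lin S.M‖)))))

/-- The tolerance `δ̄_ε`. -/
def deltaBar (ε : ℝ) : ℝ :=
  min (min (ε / (6 * ‖lin S.M‖)) (S.Delta / (S.B1 * S.lg))) (S.delta ε)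

/-- The number `K̄_ε` of outer iterations. -/
def Kbar (ε : ℝ) : ℕ := ⌈192 * S.Lf * S.Delta / ε ^ 2⌉₊

/-! ### The dual subproblem at the proximal center `x` (which will be `x⁽ᵏ⁾`) -/

/-- `[Ā; A]ᵀ z + ∇f₀(x) - τ x`. -/
def shifted (x : Vec (Fin d)) (z : Vec (Fin nb ⊕ Fin n)) : Vec (Fin d) :=
  lin S.M.transpose z + gradient S.f0 x - S.tau • x

/-- The negative dual function
`D(z) = ‖Āᵀ z₁ + Aᵀ z₂ + ∇f₀(x) - τ x‖² / (2τ) + ḡ⋆(z₁) - ⟨z₁, b̄⟩ - ⟨z₂, b⟩`. -/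
def dual (x : Vec (Fin d)) (z : Vec (Fin nb ⊕ Fin n)) : EReal :=
  ((1 / (2 * S.tau) * ‖S.shifted x z‖ ^ 2 - ⟪fstBlock z, S.bbar⟫ - ⟪sndBlock z, S.b⟫ : ℝ) : EReal)
    + conj S.gbar (fstBlock z)

/-- The minimal value of `D`. -/
def dualMin (x : Vec (Fin d)) : EReal := ⨅ z, S.dual x z

/-- The set `Ω` of minimizers of `D`. -/
def Omega (x : Vec (Fin d)) : Set (Vec (Fin nb ⊕ Fin n)) := {z | ∀ w, S.dual x z ≤ S.dual x w}

/-- The acceptance criterion for `z`: `z₁ ∈ dom ḡ⋆` and `dist(z, Ω) ≤ δ`. -/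
def Accept (x : Vec (Fin d)) (δ : ℝ) (z : Vec (Fin nb ⊕ Fin n)) : Prop :=
  conj S.gbar (fstBlock z) < ⊤ ∧ Metric.infEDist z (S.Omega x) ≤ ENNReal.ofReal δ

/-! ### The restarted accelerated proximal gradient (APG) method for the dual subproblem -/

/-- `y⁽⁰⁾ = Ā x⁽⁰⁾ + b̄`. -/
def y0 : Vec (Fin nb) := lin S.Abar S.x0 + S.bbar

/-- The initial point `(y⁽⁰⁾, A x⁽⁰⁾)`. -/
def zini : Vec (Fin nb ⊕ Fin n) := stack S.y0 (lin S.A S.x0)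

/-- The smoothness constant of the quadratic part of `D`. -/
def LD : ℝ := lamMax S.M / S.tau

/-- Gradient of the quadratic part of `D` (both blocks). -/
def dualGrad (x : Vec (Fin d)) (z : Vec (Fin nb ⊕ Fin n)) : Vec (Fin nb ⊕ Fin n) :=
  (1 / S.tau) • lin S.M (S.shifted x z) - stack S.bbar S.b

/-- One APG step on a state `(z, ẑ, α)`. -/
def apgStep (x : Vec (Fin d)) (s : Vec (Fin nb ⊕ Fin n) × Vec (Fin nb ⊕ Fin n) × ℝ) :
    Vec (Fin nb ⊕ Fin n) × Vec (Fin nb ⊕ Fin n) × ℝ :=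
  let w := s.2.1 - (1 / S.LD) • S.dualGrad x s.2.1
  let z' := stack (prox (conj S.gbar) S.LD⁻¹ (fstBlock w)) (sndBlock w)
  let α' := (1 + Real.sqrt (1 + 4 * s.2.2 ^ 2)) / 2
  (z', z' + ((s.2.2 - 1) / α') • (z' - s.1), α')

/-- One inner loop: `j` APG steps started afresh from `z`. -/
def apgLoop (x : Vec (Fin d)) (j : ℕ) (z : Vec (Fin nb ⊕ Fin n)) : Vec (Fin nb ⊕ Fin n) :=
  ((S.apgStep x)^[j] (z, z, 1)).1

/-- The output of the restarted method: `i` loops of `j` APG steps, started at `zini`. -/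
def restartedAPG (x : Vec (Fin d)) (i j : ℕ) : Vec (Fin nb ⊕ Fin n) :=
  (S.apgLoop x j)^[i] S.zini

/-- The dual gap `D(zini) - min D` (meaningful when `D(zini)` is finite). -/
def gap (x : Vec (Fin d)) : ℝ := (S.dual x S.zini - S.dualMin x).toReal

/-- The length `⌈2 √(2 L_D / ρ)⌉` of a loop, for a growth constant `ρ` of `D`. -/
def loopLength (ρ : ℝ) : ℕ := ⌈2 * Real.sqrt (2 * S.LD / ρ)⌉₊

open Classical in
/-- The number of loops: `⌈log₂ (2 (D(zini) - min D) / (ρ δ²))⌉` if `D(zini)` is finite;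
otherwise loops are performed until the acceptance criterion is met. -/
def loopCount (ρ δ : ℝ) (x : Vec (Fin d)) : ℕ :=
  if S.dual x S.zini < ⊤ then ⌈Real.logb 2 (2 * S.gap x / (ρ * δ ^ 2))⌉₊
  else sInf {i : ℕ | S.Accept x δ (S.restartedAPG x i (S.loopLength ρ))}

/-- The dual point computed by the restarted APG method. -/
def nextZ (ρ δ : ℝ) (x : Vec (Fin d)) : Vec (Fin nb ⊕ Fin n) :=
  S.restartedAPG x (S.loopCount ρ δ x) (S.loopLength ρ)

/-! ### The inexact proximal gradient method

The growth constant `ρ` used for the inner schedule may depend on the current point. -/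

/-- `x⁽ᵏ⁺¹⁾` from `x⁽ᵏ⁾` and `z⁽ᵏ⁺¹⁾`. -/
def xUpdate (x : Vec (Fin d)) (z : Vec (Fin nb ⊕ Fin n)) : Vec (Fin d) :=
  x - (1 / S.tau) • (lin S.M.transpose z + gradient S.f0 x)

/-- `y⁽ᵏ⁺¹⁾` from `x⁽ᵏ⁺¹⁾` and `z⁽ᵏ⁺¹⁾`. -/
def yUpdate (x' : Vec (Fin d)) (z : Vec (Fin nb ⊕ Fin n)) : Vec (Fin nb) :=
  prox (fun y => (S.gbar y : EReal)) S.sigma⁻¹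
    (S.sigma⁻¹ • fstBlock z + lin S.Abar x' + S.bbar)

/-- The iterates `(x⁽ᵏ⁾, y⁽ᵏ⁾)`. -/
def iter (ρ : Vec (Fin d) → ℝ) (δ : ℝ) : ℕ → Vec (Fin d) × Vec (Fin nb)
  | 0 => (S.x0, S.y0)
  | k + 1 =>
    let x := (iter ρ δ k).1
    let z := S.nextZ (ρ x) δ x
    let x' := S.xUpdate x z
    (x', S.yUpdate x' z)

/-- The iterate `x⁽ᵏ⁾`. -/
def xIter (ρ : Vec (Fin d) → ℝ) (δ : ℝ) (k : ℕ) : Vec (Fin d) := (S.iter ρ δ k).1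

/-- The total number of APG steps during the first `K` outer iterations. -/
def totalSteps (ρ : Vec (Fin d) → ℝ) (δ : ℝ) (K : ℕ) : ℕ :=
  ∑ k ∈ Finset.range K,
    S.loopCount (ρ (S.xIter ρ δ k)) δ (S.xIter ρ δ k) * S.loopLength (ρ (S.xIter ρ δ k))

/-- With `δ = δ̄_ε`, every dual point computed by the restarted APG method is accepted, and the
point `x⁽ᵏ'⁺¹⁾`, for any `k' < K̄_ε` that minimizes `‖x⁽ᵏ⁺¹⁾ - x⁽ᵏ⁾‖` over `k < K̄_ε`, is within
`ε / (12 L_f)` of an `ε`-stationary point. -/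
def FindsNearStationary (ρ : Vec (Fin d) → ℝ) (ε : ℝ) : Prop :=
  (∀ k, S.Accept (S.xIter ρ (S.deltaBar ε) k) (S.deltaBar ε)
    (S.nextZ (ρ (S.xIter ρ (S.deltaBar ε) k)) (S.deltaBar ε) (S.xIter ρ (S.deltaBar ε) k))) ∧
  0 < S.Kbar ε ∧
  ∀ k' < S.Kbar ε,
    (∀ k < S.Kbar ε,
      ‖S.xIter ρ (S.deltaBar ε) (k' + 1) - S.xIter ρ (S.deltaBar ε) k'‖
        ≤ ‖S.xIter ρ (S.deltaBar ε) (k + 1) - S.xIter ρ (S.deltaBar ε) k‖) →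
    ∃ xs, S.IsStationary ε xs ∧
      ‖S.xIter ρ (S.deltaBar ε) (k' + 1) - xs‖ ≤ ε / (12 * S.Lf)

/-! ### Growth constants -/

/-- The strong convexity constant `μ_D` of the dual function under full row rank. With it the loop
length `⌈2 √(2 L_D / μ_D)⌉` is `⌈2 √2 κ([Ā; A])⌉`. -/
def muD : ℝ := lamMin S.M / S.tau

open Classical in
/-- The vector `ν`: the common value of `(1/τ) ([Ā; A]ᵀ z + ∇f₀(x) - τ x)` over `z ∈ Ω`. -/
def nu (x : Vec (Fin d)) : Vec (Fin d) :=
  if h : (S.Omega x).Nonempty then (1 / S.tau) • S.shifted x h.some else 0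

/-- `‖(C z₁ - c)₊‖²`. -/
def violationSq {m : ℕ} (C : Matrix (Fin m) (Fin nb) ℝ) (c : Vec (Fin m))
    (z : Vec (Fin nb ⊕ Fin n)) : ℝ :=
  ∑ i, (max (lin C (fstBlock z) i - c i) 0) ^ 2

/-- `θ` is a Hoffman constant for the description
`[Ā; A]ᵀ z = τ ν - ∇f₀(x) + τ x`, `C z₁ ≤ c` of `Ω`, uniformly in the center `x`. -/
def IsHoffmanSmall {m : ℕ} (C : Matrix (Fin m) (Fin nb) ℝ) (c : Vec (Fin m)) (θ : ℝ) : Prop :=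
  ∀ x z, Metric.infDist z (S.Omega x) ≤
    θ * Real.sqrt (‖S.shifted x z - S.tau • S.nu x‖ ^ 2 + violationSq C c z)

/-- `θ` is a Hoffman constant for the description
`[Ā; A]ᵀ z = τ ν - ∇f₀(x) + τ x`, `-⟨z₁, b̄⟩ - ⟨z₂, b⟩ = min D - (τ/2) ‖ν‖²`, `C z₁ ≤ c` of `Ω`,
uniformly in the center `x`. -/
def IsHoffman {m : ℕ} (C : Matrix (Fin m) (Fin nb) ℝ) (c : Vec (Fin m)) (θ : ℝ) : Prop :=
  ∀ x z, Metric.infDist z (S.Omega x) ≤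
    θ * Real.sqrt (‖S.shifted x z - S.tau • S.nu x‖ ^ 2
      + (-⟪fstBlock z, S.bbar⟫ - ⟪sndBlock z, S.b⟫
          - (S.dualMin x).toReal + S.tau / 2 * ‖S.nu x‖ ^ 2) ^ 2
      + violationSq C c z)

open Classical in
/-- The growth constant of the dual function in the polyhedral case. -/
def rho (θ : ℝ) (x : Vec (Fin d)) : ℝ :=
  if S.bbar = 0 ∧ S.b = 0 then (θ ^ 2 * S.tau)⁻¹
  else (θ ^ 2 * (S.tau + S.gap x + 2 * S.tau * ‖S.nu x‖ ^ 2))⁻¹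

/-- `B₅` bounds `‖ν‖²` and `B₆` bounds the dual gap at the center `x`. -/
def IsBound (B5 B6 : ℝ) (x : Vec (Fin d)) : Prop :=
  ‖S.nu x‖ ^ 2 ≤ B5 ∧ S.dual x S.zini - S.dualMin x ≤ (B6 : EReal)

end Setup

end IPG

end

/-! For a dual minimizer `zs` at the center `x`, the point `exactPoint x zs` is the exact proximal
gradient step `u`. Dual optimality makes `u` feasible and makes the first block of `zs` a
subgradient of `gbar` there, so the stationarity residual at `u` is at most `(L_f + τ)‖u - x‖ = 3
L_f ‖u - x‖`. A dual point within `δ` of the minimizers displaces the primal step by at most `‖M‖δ/τ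
≤ ε/(12 L_f)`. The claimed near-stationary points are these exact points. They are feasible, and
`descent` compares consecutive ones: `F0` decreases by `L_f ‖u - x‖²` up to an error quadratic in
the displacement. Telescoping over `Kbar` iterations gives one short step, and minimality transfers
it to `k'`. The iterates `y` play no role.

For the inner method, a FISTA loop of `j` steps leaves a dual gap of at most `2 L_D dist²/j²`. Under
quadratic growth with constant `ρ`, the chosen loop length turns this into halving of the gap
(`loop_halves`). The first loop also brings a start of infinite dual value into the domain. Growth
comes from `growth_norm`, strong convexity in the seminorm `‖Mᵀ·‖`. That seminorm controls the
distance to the minimizers through `lamMin` in (a) and through the Hoffman constant in (b) and (c).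
With offsets, the residual of the second equation is controlled only on the sublevel set of the
start (`offset_residual_sq_le`), which is all the restarted method visits.

For the count, no boundedness of the iterates is needed in (a) and (b): steps are uniformly bounded
and there are `O(ε⁻²)` of them, so the dual gaps are `O(ε⁻⁴)`. The tolerance is at least a multiple
of `ε²`, so the number of loops is at most `log₂(P/ε⁸) + 2`, hence at most `13 log(Δ/ε)` for small
`ε`. In (c) the assumed bound `B6` replaces this argument. With at most `384 L_f Δ/ε²` outer
iterations and loops of length at most `4s`, where `s` is the square-root factor in the bound, the
constant is `384 · 13 · 4 = 19968`. -/

open scoped ENNReal RealInnerProductSpace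

noncomputable section

set_option linter.unusedSectionVars false

namespace IPG

/-! ### Block vectors and matrices as linear maps. -/

section Blocks

variable {ι κ μ : Type} [Fintype ι] [Fintype κ] [Fintype μ]
  [DecidableEq ι] [DecidableEq κ] [DecidableEq μ]


@[simp] lemma fstBlock_stack (a : Vec ι) (b : Vec κ) : fstBlock (stack a b) = a := rfl
@[simp] lemma sndBlock_stack (a : Vec ι) (b : Vec κ) : sndBlock (stack a b) = b := rfl
@[simp] lemma fstBlock_add (a b : Vec (ι ⊕ κ)) :
    fstBlock (a + b) = fstBlock a + fstBlock b := rfl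
@[simp] lemma sndBlock_add (a b : Vec (ι ⊕ κ)) :
    sndBlock (a + b) = sndBlock a + sndBlock b := rfl
@[simp] lemma fstBlock_sub (a b : Vec (ι ⊕ κ)) :
    fstBlock (a - b) = fstBlock a - fstBlock b := rfl
@[simp] lemma sndBlock_sub (a b : Vec (ι ⊕ κ)) :
    sndBlock (a - b) = sndBlock a - sndBlock b := rfl
@[simp] lemma fstBlock_smul (t : ℝ) (a : Vec (ι ⊕ κ)) :
    fstBlock (t • a) = t • fstBlock a := rfl
@[simp] lemma sndBlock_smul (t : ℝ) (a : Vec (ι ⊕ κ)) :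
    sndBlock (t • a) = t • sndBlock a := rfl

lemma inner_eq_blocks (a b : Vec (ι ⊕ κ)) :
    ⟪a, b⟫ = ⟪fstBlock a, fstBlock b⟫ + ⟪sndBlock a, sndBlock b⟫ := by
  simp [PiLp.inner_apply, fstBlock, sndBlock, Fintype.sum_sum_type]

lemma norm_sq_eq_blocks (a : Vec (ι ⊕ κ)) :
    ‖a‖ ^ 2 = ‖fstBlock a‖ ^ 2 + ‖sndBlock a‖ ^ 2 := by
  simp only [← real_inner_self_eq_norm_sq]
  exact inner_eq_blocks a a

lemma continuous_fstBlock : Continuous (fstBlock : Vec (ι ⊕ κ) → Vec ι) := by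
  unfold fstBlock; fun_prop

lemma continuous_sndBlock : Continuous (sndBlock : Vec (ι ⊕ κ) → Vec κ) := by
  unfold sndBlock; fun_prop

lemma lin_apply (A : Matrix ι κ ℝ) (v : Vec κ) : lin A v = Matrix.toEuclideanLin A v := rfl

lemma inner_lin_transpose (A : Matrix ι κ ℝ) (z : Vec ι) (v : Vec κ) :
    ⟪lin A.transpose z, v⟫ = ⟪z, lin A v⟫ := by
  have h := Matrix.toEuclideanLin_conjTranspose_eq_adjoint (𝕜 := ℝ) A
  rw [Matrix.conjTranspose_eq_transpose_of_trivial] at h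
  rw [lin_apply, lin_apply, h, LinearMap.adjoint_inner_left]

lemma lin_mul (A : Matrix ι κ ℝ) (B : Matrix κ μ ℝ) (v : Vec μ) :
    lin (A * B) v = lin A (lin B v) := by
  simp [lin_apply]

lemma lin_fromRows (A : Matrix ι μ ℝ) (B : Matrix κ μ ℝ) (v : Vec μ) :
    lin (Matrix.fromRows A B) v = stack (lin A v) (lin B v) := by
  ext i
  rcases i with i | i <;> rfl

lemma lin_fromRows_transpose (A : Matrix ι μ ℝ) (B : Matrix κ μ ℝ) (z : Vec (ι ⊕ κ)) :
    lin (Matrix.fromRows A B).transpose z =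
      lin A.transpose (fstBlock z) + lin B.transpose (sndBlock z) := by
  refine ext_inner_right ℝ fun v => ?_
  rw [inner_lin_transpose, lin_fromRows, inner_add_left, inner_lin_transpose, inner_lin_transpose,
    inner_eq_blocks]
  simp

lemma lin_ne_zero {A : Matrix ι κ ℝ} (hA : A ≠ 0) : ∃ v, lin A v ≠ 0 := by
  by_contra! h
  apply hA
  have : Matrix.toEuclideanLin A = 0 := LinearMap.ext fun v => h v
  simpa using this

lemma lin_transpose_injective {A : Matrix ι κ ℝ} (hA : LinearIndependent ℝ A.row) :
    Function.Injective (lin A.transpose) := by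
  intro a b hab
  have := Matrix.mulVec_injective_iff (M := A.transpose)|>.2 (by simpa using hA)
  have h2 : A.transpose.mulVec a.ofLp = A.transpose.mulVec b.ofLp := by
    simpa [lin_apply] using congrArg WithLp.ofLp hab
  exact WithLp.ofLp_injective 2 (this h2)

lemma exists_norm_le_of_fullRowRank {A : Matrix ι κ ℝ} (hA : LinearIndependent ℝ A.row) :
    ∃ c : ℝ, 0 ≤ c ∧ ∀ z, ‖z‖ ≤ c * ‖lin A.transpose z‖ := by
  obtain ⟨K, -, hK⟩ := (lin A.transpose).exists_antilipschitzWith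
    (LinearMap.ker_eq_bot.2 (lin_transpose_injective hA))
  exact ⟨K, K.2, fun z => by simpa using hK.le_mul_dist z 0⟩

end Blocks

/-! ### Extreme eigenvalues of `A Aᵀ` and bounds on `‖Aᵀ v‖`. -/

section Eigenvalues

variable {ι κ : Type} [Fintype ι] [Fintype κ] [DecidableEq ι] [DecidableEq κ]

lemma isHermitian_mul_transpose (A : Matrix ι κ ℝ) : (A * A.transpose).IsHermitian := by
  simpa using Matrix.isHermitian_mul_conjTranspose_self A

lemma hasEigenvalue_eigenvalues {H : Matrix ι ι ℝ} (hH : H.IsHermitian) (i : ι) :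
    Module.End.HasEigenvalue (Matrix.toLin' H) (hH.eigenvalues i) := by
  refine Module.End.hasEigenvalue_of_hasEigenvector (x := (hH.eigenvectorBasis i).ofLp)
    ⟨Module.End.mem_eigenspace_iff.2 ?_, ?_⟩
  · simpa using hH.mulVec_eigenvectorBasis i
  · intro h
    exact hH.eigenvectorBasis.orthonormal.ne_zero i (by ext j; exact congrFun h j)

/-- `‖Aᵀ v‖² = ⟪v, A Aᵀ v⟫`, diagonalized in an orthonormal eigenbasis of `A Aᵀ`. -/
lemma norm_lin_transpose_sq (A : Matrix ι κ ℝ) (v : Vec ι) :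
    ‖lin A.transpose v‖ ^ 2 = ∑ i, (isHermitian_mul_transpose A).eigenvalues i *
      ⟪(isHermitian_mul_transpose A).eigenvectorBasis i, v⟫ ^ 2 := by
  set hH := isHermitian_mul_transpose A
  rw [← real_inner_self_eq_norm_sq, inner_lin_transpose, ← lin_mul,
    ← hH.eigenvectorBasis.sum_inner_mul_inner]
  refine Finset.sum_congr rfl fun i _ => ?_
  have h1 : ⟪hH.eigenvectorBasis i, lin (A * A.transpose) v⟫
      = hH.eigenvalues i * ⟪hH.eigenvectorBasis i, v⟫ := by
    have h2 : lin (A * A.transpose) (hH.eigenvectorBasis i)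
        = hH.eigenvalues i • hH.eigenvectorBasis i := by
      ext j
      simpa [lin_apply] using congrFun (hH.mulVec_eigenvectorBasis i) j
    have h3 : (A * A.transpose).transpose = A * A.transpose := by simp
    rw [← inner_lin_transpose, h3, h2, real_inner_smul_left]
  rw [h1, real_inner_comm]; ring

lemma finite_eigenvalues (A : Matrix ι κ ℝ) :
    {l : ℝ | Module.End.HasEigenvalue (Matrix.toLin' (A * A.transpose)) l}.Finite :=
  Module.End.finite_hasEigenvalue _

lemma norm_lin_transpose_sq_le (A : Matrix ι κ ℝ) (v : Vec ι) :
    ‖lin A.transpose v‖ ^ 2 ≤ lamMax A * ‖v‖ ^ 2 := by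
  rw [norm_lin_transpose_sq, ← (isHermitian_mul_transpose A).eigenvectorBasis.sum_sq_inner_right,
    Finset.mul_sum]
  refine Finset.sum_le_sum fun i _ => mul_le_mul_of_nonneg_right ?_ (sq_nonneg _)
  exact le_csSup (finite_eigenvalues A).bddAbove
    (hasEigenvalue_eigenvalues (isHermitian_mul_transpose A) i)

lemma exists_lin_transpose_ne_zero {A : Matrix ι κ ℝ} (hA : A ≠ 0) :
    ∃ z, lin A.transpose z ≠ 0 :=
  lin_ne_zero (by simpa using hA)

lemma lamMax_pos {A : Matrix ι κ ℝ} (hA : A ≠ 0) : 0 < lamMax A := by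
  obtain ⟨z, hz⟩ := exists_lin_transpose_ne_zero hA
  have h := norm_lin_transpose_sq_le A z
  have h1 : 0 < ‖lin A.transpose z‖ ^ 2 := by positivity
  by_contra! h2
  nlinarith [sq_nonneg ‖z‖]

lemma eigenvalue_pos {A : Matrix ι κ ℝ} (hA : LinearIndependent ℝ A.row) (i : ι) :
    0 < (isHermitian_mul_transpose A).eigenvalues i := by
  set hH := isHermitian_mul_transpose A
  have h := norm_lin_transpose_sq A (hH.eigenvectorBasis i)
  have h1 : ∀ j, ⟪hH.eigenvectorBasis j, hH.eigenvectorBasis i⟫ = if j = i then (1 : ℝ) else 0 :=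
    fun j => orthonormal_iff_ite.1 hH.eigenvectorBasis.orthonormal j i
  have h2 : lin A.transpose (hH.eigenvectorBasis i) ≠ 0 := fun h0 =>
    hH.eigenvectorBasis.orthonormal.ne_zero i
      (lin_transpose_injective hA (by rw [h0, map_zero]))
  have h3 : 0 < ‖lin A.transpose (hH.eigenvectorBasis i)‖ ^ 2 := by positivity
  rw [h] at h3
  simpa [hH, h1] using h3

lemma lamMin_mem {A : Matrix ι κ ℝ} [Nonempty ι] (hA : LinearIndependent ℝ A.row) :
    lamMin A ∈ {l : ℝ | 0 < l ∧
      Module.End.HasEigenvalue (Matrix.toLin' (A * A.transpose)) l} := by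
  have i := Classical.arbitrary ι
  exact Set.Nonempty.csInf_mem ⟨_, eigenvalue_pos hA i, hasEigenvalue_eigenvalues _ i⟩
    ((finite_eigenvalues A).subset fun l hl => hl.2)

/-- Full row rank makes every eigenvalue of `A Aᵀ` positive, so the smallest positive one bounds
them all from below. -/
lemma lamMin_mul_le {A : Matrix ι κ ℝ} (hA : LinearIndependent ℝ A.row) (v : Vec ι) :
    lamMin A * ‖v‖ ^ 2 ≤ ‖lin A.transpose v‖ ^ 2 := by
  rw [norm_lin_transpose_sq, ← (isHermitian_mul_transpose A).eigenvectorBasis.sum_sq_inner_right,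
    Finset.mul_sum]
  refine Finset.sum_le_sum fun i _ => mul_le_mul_of_nonneg_right ?_ (sq_nonneg _)
  exact csInf_le ⟨0, fun l hl => hl.1.le⟩ ⟨eigenvalue_pos hA i, hasEigenvalue_eigenvalues _ i⟩

lemma lamMin_le_lamMax {A : Matrix ι κ ℝ} [Nonempty ι] (hA : LinearIndependent ℝ A.row) :
    lamMin A ≤ lamMax A :=
  le_csSup (finite_eigenvalues A).bddAbove (lamMin_mem hA).2

end Eigenvalues

/-! ### Subgradients, the descent lemma, and growth at minimizers. -/

section ConvexAnalysis

variable {E : Type*} [NormedAddCommGroup E] [InnerProductSpace ℝ E]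

/-- Separate the point `(y, g y)` from the open strict epigraph. The vertical component `c` of the
functional is positive, so the functional can be normalized by it. -/
lemma exists_subgradient [CompleteSpace E] {g : E → ℝ} (hg : ConvexOn ℝ Set.univ g)
    (hc : Continuous g) (y : E) : ∃ s : E, ∀ y', g y + ⟪s, y' - y⟫ ≤ g y' := by
  have hconv := hg.convex_strict_epigraph
  have hopen : IsOpen {p : E × ℝ | p.1 ∈ Set.univ ∧ g p.1 < p.2} := by
    simpa using isOpen_lt (hc.comp continuous_fst) continuous_snd
  obtain ⟨f, hf⟩ := geometric_hahn_banach_point_open hconv hopen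
    (x := (y, g y)) (by simp)
  set c := f (0, 1) with hcdef
  set l : E →L[ℝ] ℝ := f.comp (ContinuousLinearMap.inl ℝ E ℝ) with hl
  have hsplit : ∀ (a : E) (t : ℝ), f (a, t) = l a + t * c := by
    intro a t
    have : (a, t) = (a, (0 : ℝ)) + t • ((0 : E), (1 : ℝ)) := by simp
    rw [this, map_add, map_smul]; rfl
  have hcpos : 0 < c := by
    have := hf (y, g y + 1) (by simp)
    rw [hsplit, hsplit] at this
    linarith
  have hle : ∀ y', l y + g y * c ≤ l y' + g y' * c := by
    intro y'
    refine le_of_forall_pos_lt_add fun e he => ?_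
    have := hf (y', g y' + e / c) (by simp; positivity)
    rw [hsplit, hsplit] at this
    have h2 : (g y' + e / c) * c = g y' * c + e := by field_simp
    linarith
  refine ⟨-(c⁻¹ • (InnerProductSpace.toDual ℝ E).symm l), fun y' => ?_⟩
  rw [inner_neg_left, real_inner_smul_left, InnerProductSpace.toDual_symm_apply, map_sub]
  have := hle y'
  have h3 : c⁻¹ * (l y - l y') ≤ g y' - g y := by
    rw [inv_mul_le_iff₀ hcpos]; linarith
  linarith

/-- Along the segment, `f` minus its quadratic majorant has nonpositive derivative, by
Cauchy–Schwarz and the Lipschitz gradient. -/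
lemma descent_lemma [CompleteSpace E] {f : E → ℝ} {L : ℝ} (hf : Differentiable ℝ f)
    (hL : ∀ x x', ‖gradient f x - gradient f x'‖ ≤ L * ‖x - x'‖) (x y : E) :
    f y ≤ f x + ⟪gradient f x, y - x⟫ + L / 2 * ‖y - x‖ ^ 2 := by
  set d := y - x
  set ψ : ℝ → ℝ := fun t => f (x + t • d) - t * ⟪gradient f x, d⟫ - L / 2 * ‖d‖ ^ 2 * t ^ 2
  have hder : ∀ t, HasDerivAt ψ
      (⟪gradient f (x + t • d), d⟫ - ⟪gradient f x, d⟫ - L * ‖d‖ ^ 2 * t) t := by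
    intro t
    have h1 : HasDerivAt (fun t : ℝ => x + t • d) d t := by
      simpa using ((hasDerivAt_id t).smul_const d).const_add x
    have h2 := ((hf (x + t • d)).hasGradientAt.hasFDerivAt).comp_hasDerivAt t h1
    have h3 := (h2.sub ((hasDerivAt_id t).mul_const ⟪gradient f x, d⟫)).sub
      ((hasDerivAt_pow 2 t).const_mul (L / 2 * ‖d‖ ^ 2))
    have h4 : (InnerProductSpace.toDual ℝ E (gradient f (x + t • d))) d
        = ⟪gradient f (x + t • d), d⟫ := rfl
    refine h3.congr_deriv ?_
    rw [h4]
    simp only [Nat.cast_ofNat, Nat.add_one_sub_one, pow_one]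
    ring
  have hanti : AntitoneOn ψ (Set.Icc 0 1) := by
    refine antitoneOn_of_deriv_nonpos (convex_Icc 0 1)
      (fun t _ => (hder t).continuousAt.continuousWithinAt)
      (fun t _ => (hder t).differentiableAt.differentiableWithinAt) fun t ht => ?_
    rw [interior_Icc] at ht
    rw [(hder t).deriv, ← inner_sub_left]
    have h1 := real_inner_le_norm (gradient f (x + t • d) - gradient f x) d
    have h2 := hL (x + t • d) x
    rw [add_sub_cancel_left, norm_smul, Real.norm_of_nonneg ht.1.le] at h2
    nlinarith [norm_nonneg d]
  have := hanti (Set.left_mem_Icc.2 zero_le_one) (Set.right_mem_Icc.2 zero_le_one) zero_le_one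
  simp only [ψ, d, zero_smul, add_zero, zero_mul, one_smul, one_mul, sub_zero, one_pow, mul_one,
    add_sub_cancel, ne_eq, OfNat.ofNat_ne_zero, not_false_eq_true, zero_pow, mul_zero] at this ⊢
  linarith

/-- A minimizer of a function with convexity modulus `N` on a convex set satisfies the
corresponding growth condition. -/
lemma growth_of_minimizer {F : Type*} [AddCommGroup F] [Module ℝ F] {S : Set F} {Φ N : F → ℝ}
    (hS : Convex ℝ S)
    (hΦ : ∀ a ∈ S, ∀ b ∈ S, ∀ t : ℝ, 0 < t → t < 1 →
      Φ ((1 - t) • a + t • b) ≤ (1 - t) * Φ a + t * Φ b - t * (1 - t) * N (b - a))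
    {p : F} (hp : p ∈ S) (hmin : ∀ w ∈ S, Φ p ≤ Φ w) {w : F} (hw : w ∈ S) :
    Φ p + N (w - p) ≤ Φ w := by
  -- Compare `p` with the point at parameter `t` on the segment to `w` and divide by `t`; the claim
  -- is the limit `t → 0`.
  have h : ∀ t : ℝ, 0 < t → t < 1 → (1 - t) * N (w - p) ≤ Φ w - Φ p := by
    intro t h0 h1
    have h2 := hΦ p hp w hw t h0 h1
    have h3 := hmin _ (hS hp hw (by linarith : 0 ≤ 1 - t) h0.le (by ring))
    have h4 : t * ((1 - t) * N (w - p)) ≤ t * (Φ w - Φ p) := by linarith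
    exact le_of_mul_le_mul_left h4 h0
  have hlim : Filter.Tendsto (fun t : ℝ => (1 - t) * N (w - p)) (nhdsWithin 0 (Set.Ioi 0))
      (nhds ((1 - 0) * N (w - p))) :=
    (Continuous.tendsto (by fun_prop) 0).mono_left nhdsWithin_le_nhds
  have := le_of_tendsto hlim (Filter.eventually_of_mem
    (Ioo_mem_nhdsGT (zero_lt_one (α := ℝ))) fun t ht => h t ht.1 ht.2)
  linarith

lemma norm_sq_convex_combination (a b : E) (t : ℝ) :
    ‖(1 - t) • a + t • b‖ ^ 2 = (1 - t) * ‖a‖ ^ 2 + t * ‖b‖ ^ 2 - t * (1 - t) * ‖b - a‖ ^ 2 := by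
  rw [norm_add_sq_real, norm_sub_sq_real, norm_smul, norm_smul, real_inner_smul_left,
    real_inner_smul_right, mul_pow, mul_pow, Real.norm_eq_abs, Real.norm_eq_abs, sq_abs, sq_abs,
    real_inner_comm]
  ring

end ConvexAnalysis

/-! ### The accelerated proximal gradient rate, for an abstract prox-gradient map. -/

section Acceleration

variable {E : Type*} [NormedAddCommGroup E] [InnerProductSpace ℝ E]

/-- With `y` the extrapolated point, `z'` the new iterate and `z` the previous one, the weights `a -
1` and `1` on the two comparisons turn their sum into a difference of squares that telescopes. -/
lemma acceleration_identity (z z' y s : E) (a : ℝ) :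
    a * ((a - 1) * (‖z - y‖ ^ 2 - ‖z - z'‖ ^ 2) + (‖s - y‖ ^ 2 - ‖s - z'‖ ^ 2)) =
      ‖a • y - (a - 1) • z - s‖ ^ 2 - ‖a • z' - (a - 1) • z - s‖ ^ 2 := by
  simp only [← real_inner_self_eq_norm_sq, inner_sub_left, inner_sub_right, real_inner_smul_left,
    real_inner_smul_right, real_inner_comm y z, real_inner_comm z' z, real_inner_comm s z,
    real_inner_comm s y, real_inner_comm s z']
  ring

/-- The state update of the accelerated proximal gradient method with prox-gradient map `T`. -/
def accelStep (T : E → E) (s : E × E × ℝ) : E × E × ℝ :=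
  (T s.2.1, T s.2.1 + ((s.2.2 - 1) / ((1 + Real.sqrt (1 + 4 * s.2.2 ^ 2)) / 2)) •
    (T s.2.1 - s.1), (1 + Real.sqrt (1 + 4 * s.2.2 ^ 2)) / 2)

variable {T : E → E} {S : Set E} {Φ : E → ℝ} {L : ℝ}

/-- The last conjunct bounds the FISTA potential; it does not increase because the new parameter
`a'` satisfies `a'² - a' = a²`. The starting point may lie outside `S`: its value carries weight `a
- 1 = 0`, hence the alternative `p.2.2 = 1`. -/
lemma accel_invariant (hL : 0 < L) (hT : ∀ y, T y ∈ S)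
    (hkey : ∀ y, ∀ w ∈ S, Φ (T y) ≤ Φ w + L / 2 * (‖w - y‖ ^ 2 - ‖w - T y‖ ^ 2))
    {s : E} (hs : s ∈ S) (z : E) (j : ℕ) :
    let p := (accelStep T)^[j] (z, z, 1)
    ((j : ℝ) + 2) / 2 ≤ p.2.2 ∧ (p.2.2 = 1 ∨ p.1 ∈ S) ∧
      (p.2.2 ^ 2 - p.2.2) * (Φ p.1 - Φ s) +
        L / 2 * ‖p.2.2 • p.2.1 - (p.2.2 - 1) • p.1 - s‖ ^ 2 ≤ L / 2 * ‖z - s‖ ^ 2 := by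
  induction j with
  | zero => simp
  | succ j ih =>
    rw [Function.iterate_succ_apply']
    set p := (accelStep T)^[j] (z, z, 1)
    obtain ⟨h1, h2, h3⟩ := ih
    obtain ⟨x, y, a⟩ := p
    simp only [accelStep] at h1 h2 h3 ⊢
    set z' := T y
    set r := Real.sqrt (1 + 4 * a ^ 2)
    have hr : r ^ 2 = 1 + 4 * a ^ 2 := Real.sq_sqrt (by positivity)
    have hr0 : 0 ≤ r := Real.sqrt_nonneg _
    have ha1 : 1 ≤ a := by
      have : (0 : ℝ) ≤ j := Nat.cast_nonneg j
      linarith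
    have hra : 2 * a ≤ r := by nlinarith
    refine ⟨by push_cast; linarith, Or.inr (hT y), ?_⟩
    have hb : ((1 + r) / 2) ^ 2 - (1 + r) / 2 = a ^ 2 := by nlinarith
    have hb0 : (1 + r) / 2 ≠ 0 := by positivity
    rw [hb]
    -- The extrapolation coefficient is chosen so that the vector in the new potential contains only
    -- `z'` and the previous iterate `x`.
    have hvec : ((1 + r) / 2) • (z' + ((a - 1) / ((1 + r) / 2)) • (z' - x))
        - ((1 + r) / 2 - 1) • z' - s = a • z' - (a - 1) • x - s := by
      rw [smul_add, smul_smul, mul_div_cancel₀ _ hb0]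
      module
    rw [hvec]
    have hk1 := hkey y s hs
    have hk2 : (a - 1) * Φ z' ≤ (a - 1) * (Φ x + L / 2 * (‖x - y‖ ^ 2 - ‖x - z'‖ ^ 2)) := by
      rcases h2 with h2 | h2
      · simp [h2]
      · exact mul_le_mul_of_nonneg_left (hkey y x h2) (by linarith)
    have hid := acceleration_identity x z' y s a
    have := mul_le_mul_of_nonneg_left (add_le_add hk1 hk2) (by linarith : 0 ≤ a)
    nlinarith

lemma accel_rate (hL : 0 < L) (hT : ∀ y, T y ∈ S)
    (hkey : ∀ y, ∀ w ∈ S, Φ (T y) ≤ Φ w + L / 2 * (‖w - y‖ ^ 2 - ‖w - T y‖ ^ 2))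
    {s : E} (hs : s ∈ S) (hmin : ∀ w ∈ S, Φ s ≤ Φ w) (z : E) {j : ℕ} (hj : 0 < j) :
    ((accelStep T)^[j] (z, z, 1)).1 ∈ S ∧
      (j : ℝ) ^ 2 * (Φ ((accelStep T)^[j] (z, z, 1)).1 - Φ s) ≤ 2 * L * ‖z - s‖ ^ 2 := by
  obtain ⟨h1, h2, h3⟩ := accel_invariant hL hT hkey hs z j
  set p := (accelStep T)^[j] (z, z, 1)
  have hj' : (0 : ℝ) < j := by exact_mod_cast hj
  have h2 : p.1 ∈ S := h2.resolve_left fun h => by linarith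
  refine ⟨h2, ?_⟩
  have h4 := hmin _ h2
  -- The parameter is at least `(j + 2)/2`, so `a(a - 1) ≥ (j + 2)/2 · j/2`.
  have h5 : (j : ℝ) ^ 2 / 4 ≤ p.2.2 ^ 2 - p.2.2 := by nlinarith
  have h6 := mul_le_mul_of_nonneg_right h5 (sub_nonneg.2 h4)
  have h7 : 0 ≤ L / 2 * ‖p.2.2 • p.2.1 - (p.2.2 - 1) • p.1 - s‖ ^ 2 := by positivity
  linarith

end Acceleration

/-! ### The convex conjugate and its proximal mapping. -/

section Conjugate

variable {ι : Type} [Fintype ι] [DecidableEq ι] {h : Vec ι → ℝ}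

lemma conj_le_coe_iff {z : Vec ι} {c : ℝ} :
    conj h z ≤ (c : EReal) ↔ ∀ y, ⟪y, z⟫ - h y ≤ c := by
  simp only [conj, iSup_le_iff, EReal.coe_le_coe_iff]

lemma conj_ne_bot (z : Vec ι) : conj h z ≠ ⊥ := by
  have h1 : ((⟪(0 : Vec ι), z⟫ - h 0 : ℝ) : EReal) ≤ conj h z :=
    le_iSup (fun y => ((⟪y, z⟫ - h y : ℝ) : EReal)) 0
  exact ne_of_gt (lt_of_lt_of_le (EReal.bot_lt_coe _) h1)

lemma coe_toReal_conj {z : Vec ι} (hz : conj h z < ⊤) :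
    ((conj h z).toReal : EReal) = conj h z :=
  EReal.coe_toReal hz.ne (conj_ne_bot z)

lemma sub_le_conj {z : Vec ι} (hz : conj h z < ⊤) (y : Vec ι) :
    ⟪y, z⟫ - h y ≤ (conj h z).toReal :=
  conj_le_coe_iff.1 (coe_toReal_conj hz).ge y

lemma conj_lt_top_of_forall_le {z : Vec ι} {c : ℝ} (hc : ∀ y, ⟪y, z⟫ - h y ≤ c) :
    conj h z < ⊤ :=
  lt_of_le_of_lt (conj_le_coe_iff.2 hc) (EReal.coe_lt_top c)

lemma conj_le_of_forall_le {z : Vec ι} {c : ℝ} (hc : ∀ y, ⟪y, z⟫ - h y ≤ c) :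
    (conj h z).toReal ≤ c := by
  have h1 := conj_le_coe_iff.2 hc
  rw [← coe_toReal_conj (conj_lt_top_of_forall_le hc)] at h1
  exact_mod_cast h1

lemma conj_convex_combination_le {a b : Vec ι} (ha : conj h a < ⊤) (hb : conj h b < ⊤) {t : ℝ}
    (h0 : 0 ≤ t) (h1 : t ≤ 1) (y : Vec ι) :
    ⟪y, (1 - t) • a + t • b⟫ - h y ≤ (1 - t) * (conj h a).toReal + t * (conj h b).toReal := by
  have h2 := mul_le_mul_of_nonneg_left (sub_le_conj ha y) (sub_nonneg.2 h1)
  have h3 := mul_le_mul_of_nonneg_left (sub_le_conj hb y) h0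
  rw [inner_add_right, real_inner_smul_right, real_inner_smul_right]
  linarith

lemma convex_dom_conj : Convex ℝ {z : Vec ι | conj h z < ⊤} := by
  intro a ha b hb s t hs ht hst
  obtain rfl : s = 1 - t := by linarith
  exact conj_lt_top_of_forall_le
    (conj_convex_combination_le ha hb ht (by linarith))

lemma toReal_conj_convex {a b : Vec ι} (ha : conj h a < ⊤) (hb : conj h b < ⊤) {t : ℝ}
    (h0 : 0 ≤ t) (h1 : t ≤ 1) :
    (conj h ((1 - t) • a + t • b)).toReal ≤
      (1 - t) * (conj h a).toReal + t * (conj h b).toReal :=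
  conj_le_of_forall_le (conj_convex_combination_le ha hb h0 h1)

lemma lowerSemicontinuous_conj : LowerSemicontinuous (conj h) := by
  refine lowerSemicontinuous_iSup fun y => Continuous.lowerSemicontinuous ?_
  exact continuous_coe_real_ereal.comp (by fun_prop)

/-- If `‖z‖ > l`, the affine term outgrows `h` along the ray `t • z` and the conjugate is infinite.
This bound on the domain supplies the compactness for the proximal mapping and for the first dual
block. -/
lemma norm_le_of_conj_lt_top {l : ℝ} (hl0 : 0 ≤ l) (hl : ∀ y y', |h y - h y'| ≤ l * ‖y - y'‖)
    {z : Vec ι} (hz : conj h z < ⊤) : ‖z‖ ≤ l := by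
  by_contra! hlt
  set c := (conj h z).toReal + h 0
  have hz0 : 0 < ‖z‖ := hl0.trans_lt hlt
  have key : ∀ t : ℝ, 0 ≤ t → t * (‖z‖ * (‖z‖ - l)) ≤ c := by
    intro t ht
    have h1 := sub_le_conj hz (t • z)
    have h2 := (abs_le.1 (hl (t • z) 0)).2
    rw [real_inner_smul_left, real_inner_self_eq_norm_sq] at h1
    rw [sub_zero, norm_smul, Real.norm_of_nonneg ht] at h2
    nlinarith
  have hp : 0 < ‖z‖ * (‖z‖ - l) := mul_pos hz0 (by linarith)
  have h3 := key ((|c| + 1) / (‖z‖ * (‖z‖ - l))) (by positivity)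
  rw [div_mul_cancel₀ _ hp.ne'] at h3
  linarith [le_abs_self c]

lemma exists_minimizer_of_lowerSemicontinuous {f : Vec ι → EReal} (hf : LowerSemicontinuous f)
    {z₀ : Vec ι} {R : ℝ} (hR : ∀ z, f z ≤ f z₀ → ‖z‖ ≤ R) : ∃ z, ∀ w, f z ≤ f w := by
  obtain ⟨z, hz, hmin⟩ := (hf.lowerSemicontinuousOn (Metric.closedBall 0 R)).exists_isMinOn
    ⟨z₀, by simpa using hR z₀ le_rfl⟩ (isCompact_closedBall 0 R)
  refine ⟨z, fun w => ?_⟩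
  by_cases hw : ‖w‖ ≤ R
  · exact hmin (by simpa using hw)
  · have h1 : f z₀ < f w := lt_of_not_ge fun h2 => hw (hR w h2)
    exact (hmin (by simpa using hR z₀ le_rfl : z₀ ∈ Metric.closedBall 0 R)).trans h1.le

lemma lowerSemicontinuous_coe_add {f : Vec ι → EReal} (hf : LowerSemicontinuous f)
    {q : Vec ι → ℝ} (hq : Continuous q) : LowerSemicontinuous fun z => (q z : EReal) + f z := by
  refine (continuous_coe_real_ereal.comp hq).lowerSemicontinuous.add' hf fun z => ?_
  exact EReal.continuousAt_add (Or.inl (EReal.coe_ne_top _)) (Or.inl (EReal.coe_ne_bot _))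

lemma exists_isProx_conj {l : ℝ} (hl0 : 0 ≤ l) (hl : ∀ y y', |h y - h y'| ≤ l * ‖y - y'‖)
    (hne : ∃ z, conj h z < ⊤) (η : ℝ) (v : Vec ι) : ∃ u, IsProx (conj h) η v u := by
  obtain ⟨z₀, hz₀⟩ := hne
  have hlsc : LowerSemicontinuous
      fun u => ((1 / (2 * η) * ‖u - v‖ ^ 2 : ℝ) : EReal) + conj h u :=
    lowerSemicontinuous_coe_add lowerSemicontinuous_conj (by fun_prop)
  obtain ⟨u, hu⟩ := exists_minimizer_of_lowerSemicontinuous hlsc (z₀ := z₀) (R := l) fun z hz => by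
    refine norm_le_of_conj_lt_top hl0 hl (lt_top_iff_ne_top.2 fun htop => ?_)
    rw [htop, EReal.coe_add_top, ← coe_toReal_conj hz₀, ← EReal.coe_add] at hz
    exact (EReal.coe_lt_top _).not_ge hz
  exact ⟨u, fun w => by simpa only [add_comm] using hu w⟩

lemma prox_conj_lt_top {l : ℝ} (hl0 : 0 ≤ l) (hl : ∀ y y', |h y - h y'| ≤ l * ‖y - y'‖)
    (hne : ∃ z, conj h z < ⊤) (η : ℝ) (v : Vec ι) : conj h (prox (conj h) η v) < ⊤ := by
  have hp : IsProx (conj h) η v (prox (conj h) η v) :=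
    Classical.epsilon_spec (exists_isProx_conj hl0 hl hne η v)
  obtain ⟨z₀, hz₀⟩ := hne
  have h1 := hp z₀
  rw [← coe_toReal_conj hz₀, ← EReal.coe_add] at h1
  by_contra h2
  rw [not_lt_top_iff.1 h2, EReal.top_add_coe] at h1
  exact (EReal.coe_lt_top _).not_ge h1

/-- The prox objective has the convexity modulus `1/(2η)` of its quadratic term, and
`growth_of_minimizer` applies at the prox point. -/
lemma prox_conj_growth {l : ℝ} (hl0 : 0 ≤ l) (hl : ∀ y y', |h y - h y'| ≤ l * ‖y - y'‖)
    (hne : ∃ z, conj h z < ⊤) {η : ℝ} (v : Vec ι) {w : Vec ι} (hw : conj h w < ⊤) :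
    (conj h (prox (conj h) η v)).toReal + 1 / (2 * η) * ‖prox (conj h) η v - v‖ ^ 2
      + 1 / (2 * η) * ‖w - prox (conj h) η v‖ ^ 2 ≤
      (conj h w).toReal + 1 / (2 * η) * ‖w - v‖ ^ 2 := by
  have hp : IsProx (conj h) η v (prox (conj h) η v) :=
    Classical.epsilon_spec (exists_isProx_conj hl0 hl hne η v)
  have hpd := prox_conj_lt_top hl0 hl hne η v
  refine growth_of_minimizer (S := {z | conj h z < ⊤})
    (Φ := fun w => (conj h w).toReal + 1 / (2 * η) * ‖w - v‖ ^ 2)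
    (N := fun w => 1 / (2 * η) * ‖w‖ ^ 2) convex_dom_conj ?_ hpd ?_ hw
  · intro a ha b hb t h0 h1
    have h2 := toReal_conj_convex ha hb h0.le h1.le
    have h3 : (1 - t) • a + t • b - v = (1 - t) • (a - v) + t • (b - v) := by module
    have h4 : b - v - (a - v) = b - a := by abel
    simp only [h3, norm_sq_convex_combination, h4]
    linarith
  · intro w hw
    have h1 := hp w
    rw [← coe_toReal_conj hw, ← coe_toReal_conj hpd, ← EReal.coe_add, ← EReal.coe_add] at h1
    exact_mod_cast h1

end Conjugate

/-! ### The dual function, its minimizers, and the primal meaning of dual optimality. -/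

namespace Setup

variable {d n nb : ℕ} (S : Setup d n nb)

/-- The assumptions on the problem and on the input that are common to all cases. -/
structure StandingAssumptions : Prop extends
    S.ProblemAssumptions, S.LipschitzAssumptions, S.InputAssumptions where
  M_ne_zero : S.M ≠ 0
  Delta_pos : 0 < S.Delta

/-- The set of points where the dual function is finite. -/
def dualDom : Set (Vec (Fin nb ⊕ Fin n)) := {z | conj S.gbar (fstBlock z) < ⊤}

/-- The quadratic part of the dual function. -/
def dualQuad (x : Vec (Fin d)) (z : Vec (Fin nb ⊕ Fin n)) : ℝ :=
  1 / (2 * S.tau) * ‖S.shifted x z‖ ^ 2 - ⟪fstBlock z, S.bbar⟫ - ⟪sndBlock z, S.b⟫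

/-- The dual function as a real-valued function (meaningful on its domain). -/
def dualReal (x : Vec (Fin d)) (z : Vec (Fin nb ⊕ Fin n)) : ℝ :=
  S.dualQuad x z + (conj S.gbar (fstBlock z)).toReal

/-- The exact proximal step that corresponds to the dual point `z`. -/
def exactPoint (x : Vec (Fin d)) (z : Vec (Fin nb ⊕ Fin n)) : Vec (Fin d) :=
  -((1 / S.tau) • S.shifted x z)

variable {S} {x : Vec (Fin d)} {z w v zs : Vec (Fin nb ⊕ Fin n)}

lemma dual_eq_coe (hz : z ∈ S.dualDom) : S.dual x z = (S.dualReal x z : EReal) := by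
  rw [dualReal, EReal.coe_add, coe_toReal_conj hz]; rfl

lemma dual_eq_top (hz : z ∉ S.dualDom) : S.dual x z = ⊤ := by
  have : conj S.gbar (fstBlock z) = ⊤ := not_lt_top_iff.1 hz
  rw [dual, this, EReal.coe_add_top]

lemma dual_lt_top_iff : S.dual x z < ⊤ ↔ z ∈ S.dualDom := by
  by_cases hz : z ∈ S.dualDom
  · simp [dual_eq_coe hz, hz, EReal.coe_lt_top]
  · simp [dual_eq_top hz, hz]

lemma convex_dualDom : Convex ℝ S.dualDom := fun _ ha _ hb _ _ hs ht hst =>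
  convex_dom_conj ha hb hs ht hst

lemma shifted_sub (x : Vec (Fin d)) (w v : Vec (Fin nb ⊕ Fin n)) :
    S.shifted x w - S.shifted x v = lin S.M.transpose (w - v) := by
  rw [map_sub, shifted, shifted]; abel

lemma lin_M (v : Vec (Fin d)) : lin S.M v = stack (lin S.Abar v) (lin S.A v) :=
  lin_fromRows _ _ _

lemma lin_M_transpose (z : Vec (Fin nb ⊕ Fin n)) :
    lin S.M.transpose z = lin S.Abar.transpose (fstBlock z) + lin S.A.transpose (sndBlock z) :=
  lin_fromRows_transpose _ _ _

lemma lowerSemicontinuous_dual (x : Vec (Fin d)) : LowerSemicontinuous (S.dual x) := by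
  refine lowerSemicontinuous_coe_add (lowerSemicontinuous_conj.comp continuous_fstBlock) ?_
  unfold shifted
  have h1 : Continuous (fstBlock : Vec (Fin nb ⊕ Fin n) → _) := continuous_fstBlock
  have h2 : Continuous (sndBlock : Vec (Fin nb ⊕ Fin n) → _) := continuous_sndBlock
  fun_prop

lemma isClosed_Omega (x : Vec (Fin d)) : IsClosed (S.Omega x) := by
  rw [Omega, Set.ofPred_forall]
  exact isClosed_iInter fun w => (lowerSemicontinuous_dual x).isClosed_preimage (S.dual x w)

lemma dualQuad_expand (x : Vec (Fin d)) (w v : Vec (Fin nb ⊕ Fin n)) :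
    S.dualQuad x w = S.dualQuad x v + ⟪S.dualGrad x v, w - v⟫
      + 1 / (2 * S.tau) * ‖lin S.M.transpose (w - v)‖ ^ 2 := by
  have h1 : S.shifted x w = S.shifted x v + lin S.M.transpose (w - v) := by
    rw [← shifted_sub]; abel
  have h2 : ⟪S.dualGrad x v, w - v⟫ = 1 / S.tau * ⟪S.shifted x v, lin S.M.transpose (w - v)⟫
      - ⟪fstBlock w - fstBlock v, S.bbar⟫ - ⟪sndBlock w - sndBlock v, S.b⟫ := by
    rw [dualGrad, inner_sub_left, real_inner_smul_left, real_inner_comm, ← inner_lin_transpose,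
      real_inner_comm, inner_eq_blocks (stack _ _), fstBlock_stack, sndBlock_stack,
      real_inner_comm S.bbar, real_inner_comm S.b]
    simp only [fstBlock_sub, sndBlock_sub]
    ring
  have h3 : (1 : ℝ) / (2 * S.tau) = 1 / S.tau / 2 := by ring
  rw [h2, dualQuad, dualQuad, h1, norm_add_sq_real, inner_sub_left, inner_sub_left, h3]
  ring

/-- The gradient is minus the pair `(Ā u + b̄, A u + b)` at the primal point `u` attached to `v`.
Dual first-order conditions thereby become primal ones. -/
lemma inner_dualGrad (v w : Vec (Fin nb ⊕ Fin n)) :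
    ⟪S.dualGrad x v, w⟫ =
      -⟪lin S.Abar (S.exactPoint x v) + S.bbar, fstBlock w⟫
        - ⟪lin S.A (S.exactPoint x v) + S.b, sndBlock w⟫ := by
  rw [dualGrad, exactPoint, map_neg, map_neg, map_smul, map_smul, inner_sub_left,
    real_inner_smul_left, lin_M, inner_eq_blocks, inner_eq_blocks (stack S.bbar S.b)]
  simp only [fstBlock_stack, sndBlock_stack, inner_add_left, inner_neg_left, real_inner_smul_left]
  ring

lemma dualReal_strongly_convex {a b : Vec (Fin nb ⊕ Fin n)} (ha : a ∈ S.dualDom)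
    (hb : b ∈ S.dualDom) {t : ℝ} (h0 : 0 ≤ t) (h1 : t ≤ 1) :
    S.dualReal x ((1 - t) • a + t • b) ≤ (1 - t) * S.dualReal x a + t * S.dualReal x b
      - t * (1 - t) * (1 / (2 * S.tau) * ‖lin S.M.transpose (b - a)‖ ^ 2) := by
  have h2 := toReal_conj_convex ha hb h0 h1
  have h3 : S.shifted x ((1 - t) • a + t • b)
      = (1 - t) • S.shifted x a + t • S.shifted x b := by
    simp only [shifted, map_add, map_smul]; module
  have h4 : S.dualQuad x ((1 - t) • a + t • b) = (1 - t) * S.dualQuad x a + t * S.dualQuad x b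
      - t * (1 - t) * (1 / (2 * S.tau) * ‖lin S.M.transpose (b - a)‖ ^ 2) := by
    simp only [dualQuad, h3, norm_sq_convex_combination, shifted_sub, fstBlock_add, sndBlock_add,
      fstBlock_smul, sndBlock_smul, inner_add_left, real_inner_smul_left]
    ring
  simp only [dualReal, h4, fstBlock_add, fstBlock_smul]
  linarith

namespace StandingAssumptions

variable (hS : S.StandingAssumptions)
include hS

lemma tau_pos : 0 < S.tau := mul_pos two_pos hS.Lf_pos

lemma continuous_gbar : Continuous S.gbar := by
  refine (LipschitzWith.of_dist_le_mul (K := ⟨S.lg, hS.lg_pos.le⟩) fun y y' => ?_).continuous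
  rw [Real.dist_eq, dist_eq_norm]
  exact hS.gbar_lipschitz y y'

lemma exists_subgradient_gbar (y : Vec (Fin nb)) :
    ∃ s, ∀ y', S.gbar y + ⟪s, y' - y⟫ ≤ S.gbar y' :=
  exists_subgradient hS.gbar_convex hS.continuous_gbar y

lemma exists_conj_lt_top : ∃ s, conj S.gbar s < ⊤ := by
  obtain ⟨s, hs⟩ := hS.exists_subgradient_gbar 0
  refine ⟨s, conj_lt_top_of_forall_le (c := -S.gbar 0) fun y => ?_⟩
  have := hs y
  rw [sub_zero, real_inner_comm] at this
  linarith

lemma dualDom_nonempty : S.dualDom.Nonempty := by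
  obtain ⟨s, hs⟩ := hS.exists_conj_lt_top
  exact ⟨stack s 0, hs⟩

lemma norm_fstBlock_le (hz : z ∈ S.dualDom) : ‖fstBlock z‖ ≤ S.lg :=
  norm_le_of_conj_lt_top hS.lg_pos.le hS.gbar_lipschitz hz

lemma mem_Omega_iff : z ∈ S.Omega x ↔
    z ∈ S.dualDom ∧ ∀ w ∈ S.dualDom, S.dualReal x z ≤ S.dualReal x w := by
  constructor
  · intro hz
    have hzd : z ∈ S.dualDom := by
      obtain ⟨w, hw⟩ := hS.dualDom_nonempty
      exact dual_lt_top_iff.1 ((hz w).trans_lt (dual_lt_top_iff (x := x).2 hw))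
    refine ⟨hzd, fun w hw => ?_⟩
    have := hz w
    rw [dual_eq_coe hzd, dual_eq_coe hw] at this
    exact_mod_cast this
  · rintro ⟨hz, hmin⟩ w
    by_cases hw : w ∈ S.dualDom
    · rw [dual_eq_coe hz, dual_eq_coe hw]
      exact_mod_cast hmin w hw
    · rw [dual_eq_top hw]; exact le_top

lemma Omega_subset : S.Omega x ⊆ S.dualDom := fun _ hz => (hS.mem_Omega_iff.1 hz).1

/-- Feasibility of `x0` gives `b = -A x0`, and completing the square at `x0` absorbs the linear
terms in `z`. What remains is a square, constants, and a Fenchel–Young term at `y0` that is bounded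
below. -/
lemma dualReal_eq (x : Vec (Fin d)) (z : Vec (Fin nb ⊕ Fin n)) : S.dualReal x z =
    1 / (2 * S.tau) * ‖S.shifted x z + S.tau • S.x0‖ ^ 2 - S.tau / 2 * ‖S.x0‖ ^ 2
      - ⟪gradient S.f0 x - S.tau • x, S.x0⟫
      + ((conj S.gbar (fstBlock z)).toReal - ⟪fstBlock z, S.y0⟫) := by
  have hτ := hS.tau_pos
  have hb : S.b = -lin S.A S.x0 := eq_neg_of_add_eq_zero_right hS.feasible
  have h1 : ⟪S.shifted x z, S.x0⟫ = ⟪fstBlock z, lin S.Abar S.x0⟫ + ⟪sndBlock z, lin S.A S.x0⟫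
      + ⟪gradient S.f0 x - S.tau • x, S.x0⟫ := by
    rw [shifted, add_sub_assoc, inner_add_left, lin_M_transpose, inner_add_left,
      inner_lin_transpose, inner_lin_transpose]
  rw [dualReal, dualQuad, norm_add_sq_real, real_inner_smul_right, h1, norm_smul, mul_pow,
    Real.norm_of_nonneg hτ.le, y0, inner_add_right, hb, inner_neg_right]
  field_simp
  ring

lemma neg_gbar_le (hz : z ∈ S.dualDom) :
    -S.gbar S.y0 ≤ (conj S.gbar (fstBlock z)).toReal - ⟪fstBlock z, S.y0⟫ := by
  have := sub_le_conj hz S.y0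
  rw [real_inner_comm] at this
  linarith

/-- Sublevel sets are bounded: the first block has norm at most `lg`, the square in `dualReal_eq`
then bounds `Aᵀ z₂`, and full row rank of `A` bounds `z₂`. -/
lemma Omega_nonempty (x : Vec (Fin d)) : (S.Omega x).Nonempty := by
  have hτ := hS.tau_pos
  obtain ⟨z₀, hz₀⟩ := hS.dualDom_nonempty
  obtain ⟨c, hc0, hc⟩ := exists_norm_le_of_fullRowRank hS.A_fullRowRank
  set K := 2 * S.tau * (S.dualReal x z₀ + S.tau / 2 * ‖S.x0‖ ^ 2
    + ⟪gradient S.f0 x - S.tau • x, S.x0⟫ + S.gbar S.y0) with hK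
  set R := S.lg + c * (Real.sqrt K + ‖gradient S.f0 x - S.tau • x + S.tau • S.x0‖
    + ‖lin S.Abar.transpose‖ * S.lg)
  obtain ⟨z, hz⟩ := exists_minimizer_of_lowerSemicontinuous
      (lowerSemicontinuous_dual x) (z₀ := z₀) (R := R) fun z hz => by
    have hzd : z ∈ S.dualDom :=
      dual_lt_top_iff.1 (hz.trans_lt (dual_lt_top_iff (x := x).2 hz₀))
    rw [dual_eq_coe hzd, dual_eq_coe hz₀, EReal.coe_le_coe_iff, hS.dualReal_eq x z] at hz
    have h1 := hS.norm_fstBlock_le hzd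
    have h2 : ‖S.shifted x z + S.tau • S.x0‖ ≤ Real.sqrt K := by
      refine Real.le_sqrt_of_sq_le ?_
      have h3 := hS.neg_gbar_le hzd
      have h4 : ‖S.shifted x z + S.tau • S.x0‖ ^ 2
          = 2 * S.tau * (1 / (2 * S.tau) * ‖S.shifted x z + S.tau • S.x0‖ ^ 2) := by
        field_simp
      rw [h4, hK]
      refine mul_le_mul_of_nonneg_left ?_ (by positivity)
      linarith
    have h5 : lin S.A.transpose (sndBlock z) = S.shifted x z + S.tau • S.x0
        - (gradient S.f0 x - S.tau • x + S.tau • S.x0)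
        - lin S.Abar.transpose (fstBlock z) := by
      rw [shifted, lin_M_transpose]; abel
    have h6 : ‖lin S.A.transpose (sndBlock z)‖ ≤ Real.sqrt K
        + ‖gradient S.f0 x - S.tau • x + S.tau • S.x0‖ + ‖lin S.Abar.transpose‖ * S.lg := by
      rw [h5]
      refine (norm_sub_le _ _).trans (add_le_add ((norm_sub_le _ _).trans ?_) ?_)
      · gcongr
      · exact (ContinuousLinearMap.le_opNorm _ _).trans (by gcongr)
    have h7 : ‖sndBlock z‖ ≤ c * (Real.sqrt K + ‖gradient S.f0 x - S.tau • x + S.tau • S.x0‖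
      + ‖lin S.Abar.transpose‖ * S.lg) := (hc _).trans (by gcongr)
    have h8 := norm_sq_eq_blocks z
    have h9 : ‖z‖ ≤ ‖fstBlock z‖ + ‖sndBlock z‖ := by
      refine abs_le_of_sq_le_sq' ?_ (by positivity) |>.2
      nlinarith [norm_nonneg (fstBlock z), norm_nonneg (sndBlock z)]
    linarith
  exact ⟨z, hz⟩

lemma dualMin_eq (hzs : zs ∈ S.Omega x) : S.dualMin x = (S.dualReal x zs : EReal) := by
  rw [← dual_eq_coe (hS.Omega_subset hzs)]
  exact le_antisymm (iInf_le _ _) (le_iInf hzs)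

lemma growth_norm (hzs : zs ∈ S.Omega x) (hz : z ∈ S.dualDom) :
    S.dualReal x zs + 1 / (2 * S.tau) * ‖lin S.M.transpose (z - zs)‖ ^ 2 ≤ S.dualReal x z :=
  growth_of_minimizer (N := fun v => 1 / (2 * S.tau) * ‖lin S.M.transpose v‖ ^ 2)
    convex_dualDom (fun _ ha _ hb _ h0 h1 => dualReal_strongly_convex ha hb h0.le h1.le)
    (hS.mem_Omega_iff.1 hzs).1 (hS.mem_Omega_iff.1 hzs).2 hz

/-- The quadratic term in `growth_norm` is exactly the second-order term of the expansion at `zs`,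
so the two cancel. -/
lemma first_order (hzs : zs ∈ S.Omega x) (hz : z ∈ S.dualDom) :
    0 ≤ ⟪S.dualGrad x zs, z - zs⟫
      + ((conj S.gbar (fstBlock z)).toReal - (conj S.gbar (fstBlock zs)).toReal) := by
  have h1 := hS.growth_norm hzs hz
  have h2 := dualQuad_expand (S := S) x z zs
  rw [dualReal, dualReal, h2] at h1
  linarith

lemma shifted_eq (hzs : zs ∈ S.Omega x) (hz : z ∈ S.Omega x) :
    S.shifted x z = S.shifted x zs := by
  have hτ := hS.tau_pos
  have h1 := hS.growth_norm hzs (hS.Omega_subset hz)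
  have h2 := (hS.mem_Omega_iff.1 hz).2 zs (hS.Omega_subset hzs)
  rw [← sub_eq_zero, shifted_sub]
  have h3 : 1 / (2 * S.tau) * ‖lin S.M.transpose (z - zs)‖ ^ 2 ≤ 0 := by linarith
  have h4 : ‖lin S.M.transpose (z - zs)‖ ^ 2 ≤ 0 := by
    by_contra! h5
    have : 0 < 1 / (2 * S.tau) * ‖lin S.M.transpose (z - zs)‖ ^ 2 := by positivity
    linarith
  exact norm_eq_zero.1 (pow_eq_zero_iff two_ne_zero |>.1 (le_antisymm h4 (sq_nonneg _)))

lemma tau_smul_nu (hzs : zs ∈ S.Omega x) : S.tau • S.nu x = S.shifted x zs := by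
  have h : (S.Omega x).Nonempty := ⟨zs, hzs⟩
  rw [nu, dif_pos h, smul_smul, mul_one_div_cancel hS.tau_pos.ne', one_smul]
  exact hS.shifted_eq hzs h.some_mem

/-- Moving `zs` by the residual `r` in the second block does not affect the conjugate, so the
first-order condition reads `0 ≤ -‖r‖²`. -/
lemma exactPoint_feasible (hzs : zs ∈ S.Omega x) : lin S.A (S.exactPoint x zs) + S.b = 0 := by
  set r := lin S.A (S.exactPoint x zs) + S.b
  have hz : zs + stack 0 r ∈ S.dualDom := by
    change conj S.gbar (fstBlock zs + 0) < ⊤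
    rw [add_zero]; exact hS.Omega_subset hzs
  have h1 := hS.first_order hzs hz
  rw [inner_dualGrad] at h1
  simp only [add_sub_cancel_left, fstBlock_stack, sndBlock_stack, inner_zero_right, fstBlock_add,
    add_zero, sub_self] at h1
  have h2 : ⟪r, r⟫ ≤ 0 := by linarith
  exact norm_eq_zero.1 (pow_eq_zero_iff two_ne_zero |>.1
    (le_antisymm (by rwa [← real_inner_self_eq_norm_sq]) (sq_nonneg _)))

/-- Replacing the first block by a subgradient `s` of `gbar` at `y`, where Fenchel–Young is an
equality, shows through the first-order condition that the equality also holds at the first block of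
`zs`. -/
lemma fstBlock_mem_subdiff (hzs : zs ∈ S.Omega x) :
    fstBlock zs ∈ subdiff S.gbar (lin S.Abar (S.exactPoint x zs) + S.bbar) := by
  set y := lin S.Abar (S.exactPoint x zs) + S.bbar
  obtain ⟨s, hs⟩ := hS.exists_subgradient_gbar y
  have hle : ∀ y', ⟪y', s⟫ - S.gbar y' ≤ ⟪y, s⟫ - S.gbar y := by
    intro y'
    have := hs y'
    rw [inner_sub_right, real_inner_comm, real_inner_comm y s] at this
    linarith
  have hsd : stack s (sndBlock zs) ∈ S.dualDom := conj_lt_top_of_forall_le hle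
  have h1 := hS.first_order hzs hsd
  rw [inner_dualGrad] at h1
  simp only [fstBlock_sub, sndBlock_sub, fstBlock_stack, sndBlock_stack, sub_self,
    inner_zero_right, inner_sub_right, sub_zero] at h1
  have h2 := conj_le_of_forall_le hle
  intro y'
  have h3 := sub_le_conj (hS.Omega_subset hzs) y'
  rw [inner_sub_right, real_inner_comm, real_inner_comm y (fstBlock zs)]
  linarith

lemma dualReal_sub_le (hzs : zs ∈ S.Omega x) (z : Vec (Fin nb ⊕ Fin n)) :
    S.dualReal x z - S.dualReal x zs ≤ 1 / (2 * S.tau) * ‖S.shifted x z + S.tau • S.x0‖ ^ 2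
      + ((conj S.gbar (fstBlock z)).toReal - ⟪fstBlock z, S.y0⟫ + S.gbar S.y0) := by
  have hτ := hS.tau_pos
  rw [hS.dualReal_eq x z, hS.dualReal_eq x zs]
  have h1 := hS.neg_gbar_le (hS.Omega_subset hzs)
  have h2 : 0 ≤ 1 / (2 * S.tau) * ‖S.shifted x zs + S.tau • S.x0‖ ^ 2 := by positivity
  linarith

lemma gap_eq (hzs : zs ∈ S.Omega x) (hz : S.zini ∈ S.dualDom) :
    S.gap x = S.dualReal x S.zini - S.dualReal x zs := by
  rw [gap, hS.dualMin_eq hzs, dual_eq_coe hz, ← EReal.coe_sub, EReal.toReal_coe]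

end StandingAssumptions
end Setup

/-! ### The restarted accelerated method under quadratic growth. -/

lemma le_two_pow_ceil_logb (y : ℝ) : y ≤ 2 ^ ⌈Real.logb 2 y⌉₊ := by
  rcases le_or_gt y 0 with hy | hy
  · exact hy.trans (by positivity)
  · rw [← Real.rpow_natCast, ← Real.logb_le_iff_le_rpow one_lt_two hy]
    exact Nat.le_ceil _

lemma ceil_logb_mono {a b : ℝ} (ha : 0 ≤ a) (hab : a ≤ b) :
    ⌈Real.logb 2 a⌉₊ ≤ ⌈Real.logb 2 b⌉₊ := by
  rcases ha.eq_or_lt with rfl | ha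
  · simp
  · exact Nat.ceil_mono (Real.logb_le_logb_of_le one_lt_two ha hab)

namespace Setup

variable {d n nb : ℕ} (S : Setup d n nb)

/-- One proximal gradient step for the dual function. -/
def proxGrad (x : Vec (Fin d)) (v : Vec (Fin nb ⊕ Fin n)) : Vec (Fin nb ⊕ Fin n) :=
  stack (prox (conj S.gbar) S.LD⁻¹ (fstBlock (v - (1 / S.LD) • S.dualGrad x v)))
    (sndBlock (v - (1 / S.LD) • S.dualGrad x v))

/-- Quadratic growth of the dual function with constant `ρ`, on the part of the domain that the
restarted method can visit. -/
def HasGrowth (ρ : ℝ) (x : Vec (Fin d)) : Prop :=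
  ∀ z ∈ S.dualDom, (S.zini ∈ S.dualDom → S.dualReal x z ≤ S.dualReal x S.zini) →
    ∀ zs ∈ S.Omega x, ρ / 2 * Metric.infDist z (S.Omega x) ^ 2 ≤ S.dualReal x z - S.dualReal x zs

variable {S} {x : Vec (Fin d)} {z w v zs : Vec (Fin nb ⊕ Fin n)}

namespace StandingAssumptions

variable (hS : S.StandingAssumptions)
include hS

lemma LD_pos : 0 < S.LD := div_pos (lamMax_pos hS.M_ne_zero) hS.tau_pos

lemma proxGrad_mem (x : Vec (Fin d)) (v : Vec (Fin nb ⊕ Fin n)) : S.proxGrad x v ∈ S.dualDom :=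
  prox_conj_lt_top hS.lg_pos.le hS.gbar_lipschitz hS.exists_conj_lt_top _ _

lemma norm_sq_le_LD (v : Vec (Fin nb ⊕ Fin n)) :
    1 / (2 * S.tau) * ‖lin S.M.transpose v‖ ^ 2 ≤ S.LD / 2 * ‖v‖ ^ 2 := by
  have hτ := hS.tau_pos
  have h := mul_le_mul_of_nonneg_left (norm_lin_transpose_sq_le S.M v)
    (by positivity : 0 ≤ 1 / (2 * S.tau))
  refine h.trans_eq ?_
  rw [LD]; field_simp

/-- Completing the square turns the prox-gradient step into a minimization of the model of curvature
`L_D`, which majorizes the dual. The second block is a plain gradient step, so its growth is an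
identity. The point `v` may lie outside the domain. -/
lemma proxGrad_le (x : Vec (Fin d)) (v : Vec (Fin nb ⊕ Fin n)) (hw : w ∈ S.dualDom) :
    S.dualReal x (S.proxGrad x v) ≤
      S.dualReal x w + S.LD / 2 * (‖w - v‖ ^ 2 - ‖w - S.proxGrad x v‖ ^ 2) := by
  have hL := hS.LD_pos
  have hτ := hS.tau_pos
  set p := S.proxGrad x v with hp
  set G := S.dualGrad x v
  set y := v - (1 / S.LD) • G with hy
  have h1 := prox_conj_growth hS.lg_pos.le hS.gbar_lipschitz hS.exists_conj_lt_top
    (η := S.LD⁻¹) (fstBlock y) hw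
  have hp1 : prox (conj S.gbar) S.LD⁻¹ (fstBlock y) = fstBlock p := rfl
  have hp2 : sndBlock p = sndBlock y := rfl
  have hη : 1 / (2 * S.LD⁻¹) = S.LD / 2 := by field_simp
  rw [hp1, hη] at h1
  have h2 := norm_sq_eq_blocks (p - y)
  have h3 := norm_sq_eq_blocks (w - p)
  have h4 := norm_sq_eq_blocks (w - y)
  simp only [fstBlock_sub, sndBlock_sub, hp2, sub_self, norm_zero] at h2 h3 h4
  have hexp : ∀ a, S.LD / 2 * ‖a - y‖ ^ 2 =
      S.LD / 2 * ‖a - v‖ ^ 2 + ⟪G, a - v⟫ + 1 / (2 * S.LD) * ‖G‖ ^ 2 := by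
    intro a
    have : a - y = (a - v) + (1 / S.LD) • G := by rw [hy]; abel
    rw [this, norm_add_sq_real, norm_smul, mul_pow, real_inner_smul_right, real_inner_comm,
      Real.norm_of_nonneg (by positivity)]
    field_simp
  have h5 := hexp p
  have h6 := hexp w
  rw [h2] at h5
  rw [h4] at h6
  have h7 := dualQuad_expand (S := S) x p v
  have h8 := dualQuad_expand (S := S) x w v
  have h9 := hS.norm_sq_le_LD (p - v)
  have h10 : 0 ≤ 1 / (2 * S.tau) * ‖lin S.M.transpose (w - v)‖ ^ 2 := by positivity
  rw [dualReal, dualReal, h7, h8, h3]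
  linarith

lemma exists_dist_eq (x : Vec (Fin d)) (z : Vec (Fin nb ⊕ Fin n)) :
    ∃ zs ∈ S.Omega x, ‖z - zs‖ = Metric.infDist z (S.Omega x) := by
  obtain ⟨zs, h1, h2⟩ := (isClosed_Omega x).exists_infDist_eq_dist (hS.Omega_nonempty x) z
  exact ⟨zs, h1, by rw [h2, dist_eq_norm]⟩

lemma dualReal_eq_of_mem (hzs : zs ∈ S.Omega x) (hz : z ∈ S.Omega x) :
    S.dualReal x z = S.dualReal x zs :=
  le_antisymm ((hS.mem_Omega_iff.1 hz).2 _ (hS.Omega_subset hzs))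
    ((hS.mem_Omega_iff.1 hzs).2 _ (hS.Omega_subset hz))

lemma apgLoop_spec {j : ℕ} (hj : 0 < j) (z : Vec (Fin nb ⊕ Fin n)) (hzs : zs ∈ S.Omega x) :
    S.apgLoop x j z ∈ S.dualDom ∧ (j : ℝ) ^ 2 * (S.dualReal x (S.apgLoop x j z)
      - S.dualReal x zs) ≤ 2 * S.LD * Metric.infDist z (S.Omega x) ^ 2 := by
  obtain ⟨s, hs, hd⟩ := hS.exists_dist_eq x z
  obtain ⟨hsd, hmin⟩ := hS.mem_Omega_iff.1 hs
  rw [← hd, ← hS.dualReal_eq_of_mem hzs hs]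
  exact accel_rate hS.LD_pos (hS.proxGrad_mem x) (fun v w hw => hS.proxGrad_le x v hw)
    hsd hmin z hj

lemma loopLength_pos {ρ : ℝ} (hρ : 0 < ρ) : 0 < S.loopLength ρ := by
  have := hS.LD_pos
  exact Nat.ceil_pos.2 (by positivity)

/-- The loop length gives `j² ≥ 8 L_D/ρ`, hence the factor `2 L_D/j² ≤ ρ/4`. Since `z` need not lie
in the domain, this also covers the first loop from an infinite start. -/
lemma loop_dist_bound {ρ : ℝ} (hρ : 0 < ρ) (z : Vec (Fin nb ⊕ Fin n)) (hzs : zs ∈ S.Omega x) :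
    S.apgLoop x (S.loopLength ρ) z ∈ S.dualDom ∧
      S.dualReal x (S.apgLoop x (S.loopLength ρ) z) - S.dualReal x zs ≤
        ρ / 4 * Metric.infDist z (S.Omega x) ^ 2 := by
  have hL := hS.LD_pos
  obtain ⟨h1, h2⟩ := hS.apgLoop_spec (hS.loopLength_pos hρ) z hzs
  refine ⟨h1, ?_⟩
  have h3 : 2 * Real.sqrt (2 * S.LD / ρ) ≤ S.loopLength ρ := Nat.le_ceil _
  have h4 : 8 * S.LD / ρ ≤ (S.loopLength ρ : ℝ) ^ 2 := by
    have h5 := pow_le_pow_left₀ (by positivity) h3 2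
    rw [mul_pow, Real.sq_sqrt (by positivity)] at h5
    exact le_trans (le_of_eq (by ring)) h5
  have h6 := (hS.mem_Omega_iff.1 hzs).2 _ h1
  have h7 := (mul_le_mul_of_nonneg_right h4 (sub_nonneg.2 h6)).trans h2
  rw [div_mul_eq_mul_div, div_le_iff₀ hρ] at h7
  have h8 : 8 * S.LD * (S.dualReal x (S.apgLoop x (S.loopLength ρ) z) - S.dualReal x zs) ≤
      8 * S.LD * (ρ / 4 * Metric.infDist z (S.Omega x) ^ 2) := by linarith
  exact le_of_mul_le_mul_left h8 (by positivity)

lemma loop_halves {ρ : ℝ} (hρ : 0 < ρ) (hg : S.HasGrowth ρ x) (hz : z ∈ S.dualDom)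
    (hz' : S.zini ∈ S.dualDom → S.dualReal x z ≤ S.dualReal x S.zini) (hzs : zs ∈ S.Omega x) :
    S.apgLoop x (S.loopLength ρ) z ∈ S.dualDom ∧
      S.dualReal x (S.apgLoop x (S.loopLength ρ) z) - S.dualReal x zs ≤
        1 / 2 * (S.dualReal x z - S.dualReal x zs) := by
  obtain ⟨h1, h2⟩ := hS.loop_dist_bound hρ z hzs
  have h3 := hg z hz hz' zs hzs
  exact ⟨h1, by linarith⟩

lemma restartedAPG_succ (x : Vec (Fin d)) (i j : ℕ) :
    S.restartedAPG x (i + 1) j = S.apgLoop x j (S.restartedAPG x i j) :=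
  Function.iterate_succ_apply' _ _ _

lemma restart_of_mem {ρ : ℝ} (hρ : 0 < ρ) (hg : S.HasGrowth ρ x) (hini : S.zini ∈ S.dualDom)
    (hzs : zs ∈ S.Omega x) (i : ℕ) :
    S.restartedAPG x i (S.loopLength ρ) ∈ S.dualDom ∧
      S.dualReal x (S.restartedAPG x i (S.loopLength ρ)) - S.dualReal x zs ≤
        (1 / 2) ^ i * (S.dualReal x S.zini - S.dualReal x zs) := by
  have h0 := (hS.mem_Omega_iff.1 hzs).2 _ hini
  induction i with
  | zero => exact ⟨hini, by simp [restartedAPG]⟩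
  | succ i ih =>
    have h1 : (1 / 2 : ℝ) ^ i ≤ 1 := pow_le_one₀ (by norm_num) (by norm_num)
    -- The gap never exceeds its initial value, so the iterate stays in the sublevel set where
    -- growth is available.
    obtain ⟨h2, h3⟩ := hS.loop_halves hρ hg ih.1 (fun _ => by nlinarith [ih.2]) hzs
    rw [hS.restartedAPG_succ, pow_succ]
    exact ⟨h2, by linarith [ih.2]⟩

/-- The first loop is spent on entering the domain, so only the remaining `i` loops halve the gap.
-/
lemma restart_of_notMem {ρ : ℝ} (hρ : 0 < ρ) (hg : S.HasGrowth ρ x) (hini : S.zini ∉ S.dualDom)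
    (hzs : zs ∈ S.Omega x) (i : ℕ) :
    S.restartedAPG x (i + 1) (S.loopLength ρ) ∈ S.dualDom ∧
      S.dualReal x (S.restartedAPG x (i + 1) (S.loopLength ρ)) - S.dualReal x zs ≤
        (1 / 2) ^ i * (ρ / 4 * Metric.infDist S.zini (S.Omega x) ^ 2) := by
  induction i with
  | zero =>
    rw [pow_zero, one_mul]
    exact hS.loop_dist_bound hρ S.zini hzs
  | succ i ih =>
    obtain ⟨h2, h3⟩ := hS.loop_halves hρ hg ih.1 (fun h => absurd h hini) hzs
    rw [hS.restartedAPG_succ, pow_succ]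
    exact ⟨h2, by linarith [ih.2]⟩

lemma accept_of_infDist_le {δ : ℝ} (hz : z ∈ S.dualDom)
    (h : Metric.infDist z (S.Omega x) ≤ δ) : S.Accept x δ z := by
  refine ⟨hz, ?_⟩
  rw [← ENNReal.ofReal_toReal (Metric.infEDist_ne_top (hS.Omega_nonempty x))]
  exact ENNReal.ofReal_le_ofReal h

lemma accept_of_gap_le {ρ δ : ℝ} (hρ : 0 < ρ) (hδ : 0 ≤ δ) (hg : S.HasGrowth ρ x)
    (hz : z ∈ S.dualDom) (hz' : S.zini ∈ S.dualDom → S.dualReal x z ≤ S.dualReal x S.zini)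
    (hzs : zs ∈ S.Omega x) (h : S.dualReal x z - S.dualReal x zs ≤ ρ / 2 * δ ^ 2) :
    S.Accept x δ z := by
  refine hS.accept_of_infDist_le hz ?_
  have h1 := (hg z hz hz' zs hzs).trans h
  exact abs_le_of_sq_le_sq' (le_of_mul_le_mul_left h1 (by positivity)) hδ |>.2

lemma accept_of_notMem {ρ δ : ℝ} (hρ : 0 < ρ) (hδ : 0 < δ) (hg : S.HasGrowth ρ x)
    (hini : S.zini ∉ S.dualDom) :
    S.Accept x δ (S.restartedAPG x
      (⌈Real.logb 2 (Metric.infDist S.zini (S.Omega x) ^ 2 / δ ^ 2)⌉₊ + 1) (S.loopLength ρ)) := by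
  obtain ⟨zs, hzs⟩ := hS.Omega_nonempty x
  set D := Metric.infDist S.zini (S.Omega x)
  set i := ⌈Real.logb 2 (D ^ 2 / δ ^ 2)⌉₊
  obtain ⟨h1, h2⟩ := hS.restart_of_notMem hρ hg hini hzs i
  refine hS.accept_of_gap_le hρ hδ.le hg h1 (fun h => absurd h hini) hzs (h2.trans ?_)
  have h3 : D ^ 2 ≤ 2 ^ i * δ ^ 2 := by
    rw [← div_le_iff₀ (by positivity)]; exact le_two_pow_ceil_logb _
  have h4 : (1 / 2 : ℝ) ^ i * D ^ 2 ≤ δ ^ 2 := by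
    rw [one_div, inv_pow, inv_mul_le_iff₀ (by positivity)]; exact h3
  nlinarith [mul_le_mul_of_nonneg_left h4 hρ.le, mul_nonneg hρ.le (sq_nonneg δ)]

lemma accept_nextZ {ρ δ : ℝ} (hρ : 0 < ρ) (hδ : 0 < δ) (hg : S.HasGrowth ρ x) :
    S.Accept x δ (S.nextZ ρ δ x) := by
  by_cases hini : S.zini ∈ S.dualDom
  · obtain ⟨zs, hzs⟩ := hS.Omega_nonempty x
    have h0 := (hS.mem_Omega_iff.1 hzs).2 _ hini
    rw [nextZ, loopCount, if_pos (dual_lt_top_iff.2 hini), hS.gap_eq hzs hini]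
    set i := ⌈Real.logb 2 (2 * (S.dualReal x S.zini - S.dualReal x zs) / (ρ * δ ^ 2))⌉₊ with hi
    obtain ⟨h1, h2⟩ := hS.restart_of_mem hρ hg hini hzs i
    have h5 : (1 / 2 : ℝ) ^ i ≤ 1 := pow_le_one₀ (by norm_num) (by norm_num)
    refine hS.accept_of_gap_le hρ hδ.le hg h1 (fun _ => by nlinarith) hzs (h2.trans ?_)
    have h3 : 2 * (S.dualReal x S.zini - S.dualReal x zs) ≤ 2 ^ i * (ρ * δ ^ 2) := by
      rw [← div_le_iff₀ (by positivity)]; exact le_two_pow_ceil_logb _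
    rw [one_div, inv_pow, inv_mul_le_iff₀ (by positivity)]
    linarith
  · rw [nextZ, loopCount, if_neg (fun h => hini (dual_lt_top_iff.1 h))]
    exact Nat.sInf_mem (s := {i | S.Accept x δ (S.restartedAPG x i (S.loopLength ρ))})
      ⟨_, hS.accept_of_notMem hρ hδ hg hini⟩

/-- One bound for both starts. If `zini` has finite value, then `z = zini`. Otherwise `z` is any
point of the domain and `dist(zini, Ω)² ≤ 2 dist(z, Ω)² + 2 ‖zini - z‖²`, where growth bounds
`dist(z, Ω)` by the gap at `z`. -/
lemma loopCount_le {ρ δ P : ℝ} (hρ : 0 < ρ) (hδ : 0 < δ) (hg : S.HasGrowth ρ x)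
    (hz : z ∈ S.dualDom) (hz' : S.zini ∈ S.dualDom → z = S.zini) (hzs : zs ∈ S.Omega x)
    (hP : 2 * ‖S.zini - z‖ ^ 2 + 4 / ρ * (S.dualReal x z - S.dualReal x zs) ≤ P) :
    S.loopCount ρ δ x ≤ ⌈Real.logb 2 (P / δ ^ 2)⌉₊ + 1 := by
  have h0 := sub_nonneg.2 ((hS.mem_Omega_iff.1 hzs).2 _ hz)
  by_cases hini : S.zini ∈ S.dualDom
  · rw [loopCount, if_pos (dual_lt_top_iff.2 hini), hS.gap_eq hzs hini, ← hz' hini]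
    refine (ceil_logb_mono (by positivity) ?_).trans (Nat.le_succ _)
    have h1 : 2 * (S.dualReal x z - S.dualReal x zs) / ρ ≤ P := by
      refine le_trans ?_ hP
      have h2 : 0 ≤ (S.dualReal x z - S.dualReal x zs) / ρ := by positivity
      have h3 : 4 / ρ * (S.dualReal x z - S.dualReal x zs)
          = 4 * ((S.dualReal x z - S.dualReal x zs) / ρ) := by ring
      rw [h3, mul_div_assoc]
      nlinarith [sq_nonneg ‖S.zini - z‖]
    rw [← div_div]
    gcongr
  · rw [loopCount, if_neg (fun h => hini (dual_lt_top_iff.1 h))]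
    refine (Nat.sInf_le (hS.accept_of_notMem hρ hδ hg hini)).trans ?_
    refine Nat.succ_le_succ (ceil_logb_mono (by positivity) ?_)
    have h1 : Metric.infDist S.zini (S.Omega x) ≤
        Metric.infDist z (S.Omega x) + ‖S.zini - z‖ := by
      rw [← dist_eq_norm]; exact Metric.infDist_le_infDist_add_dist
    have h2 := hg z hz (fun h => absurd h hini) zs hzs
    have h3 : 2 * Metric.infDist z (S.Omega x) ^ 2 ≤
        4 / ρ * (S.dualReal x z - S.dualReal x zs) := by
      rw [div_mul_eq_mul_div, le_div_iff₀ hρ]; linarith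
    have h4 : (0 : ℝ) ≤ Metric.infDist S.zini (S.Omega x) := Metric.infDist_nonneg
    gcongr
    refine le_trans ?_ hP
    nlinarith [sq_nonneg (Metric.infDist z (S.Omega x) - ‖S.zini - z‖)]

/-! ### Quadratic growth -/

lemma nonempty_rows : Nonempty (Fin nb ⊕ Fin n) := by
  by_contra h
  rw [not_nonempty_iff] at h
  exact hS.M_ne_zero (Subsingleton.elim _ _)

lemma muD_pos (hM : S.StackedFullRowRank) : 0 < S.muD := by
  have := hS.nonempty_rows
  exact div_pos (lamMin_mem hM).1 hS.tau_pos

lemma infDist_le_norm (hzs : zs ∈ S.Omega x) (z : Vec (Fin nb ⊕ Fin n)) :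
    Metric.infDist z (S.Omega x) ≤ ‖z - zs‖ := by
  rw [← dist_eq_norm]; exact Metric.infDist_le_dist_of_mem hzs

lemma hasGrowth_muD (hM : S.StackedFullRowRank) (x : Vec (Fin d)) : S.HasGrowth S.muD x := by
  intro z hz _ zs hzs
  have hτ := hS.tau_pos
  have h1 := hS.growth_norm hzs hz
  have h2 := lamMin_mul_le hM (z - zs)
  have h3 : S.muD / 2 * Metric.infDist z (S.Omega x) ^ 2 ≤ S.muD / 2 * ‖z - zs‖ ^ 2 :=
    mul_le_mul_of_nonneg_left (pow_le_pow_left₀ Metric.infDist_nonneg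
      (hS.infDist_le_norm hzs z) 2) (half_pos (hS.muD_pos hM)).le
  have h4 : S.muD / 2 * ‖z - zs‖ ^ 2 ≤ 1 / (2 * S.tau) * ‖lin S.M.transpose (z - zs)‖ ^ 2 := by
    refine le_trans (le_of_eq ?_) (mul_le_mul_of_nonneg_left h2 (by positivity))
    rw [muD]; field_simp
  linarith

lemma exists_notMem_Omega (x : Vec (Fin d)) : ∃ z, z ∉ S.Omega x := by
  by_contra! h
  obtain ⟨v, hv⟩ := exists_lin_transpose_ne_zero hS.M_ne_zero
  have h1 := hS.shifted_eq (h 0) (h v)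
  rw [← sub_eq_zero, shifted_sub, sub_zero] at h1
  exact hv h1

lemma infDist_pos (hz : z ∉ S.Omega x) : 0 < Metric.infDist z (S.Omega x) :=
  ((isClosed_Omega x).notMem_iff_infDist_pos (hS.Omega_nonempty x)).1 hz

section Polyhedral

variable {m : ℕ} {C : Matrix (Fin m) (Fin nb) ℝ} {c : Vec (Fin m)}

omit hS in
-- A point outside the polyhedron is strictly separated from it by some `y`. As `gbar` is a support
-- function, `⟪s, ·⟫ - gbar` grows linearly along the ray of `y`, and the conjugate at `s` is
-- infinite.
lemma mem_polyhedron (hC : S.Polyhedral C c) {s : Vec (Fin nb)} (hs : conj S.gbar s < ⊤) :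
    ∀ i, lin C s i ≤ c i := by
  by_contra hsU
  set U : Set (Vec (Fin nb)) := {u | ∀ i, lin C u i ≤ c i} with hU
  have hUc : Convex ℝ U := by
    intro a ha b hb t r ht hr htr i
    have h1 := mul_le_mul_of_nonneg_left (ha i) ht
    have h2 := mul_le_mul_of_nonneg_left (hb i) hr
    rw [map_add, map_smul, map_smul]
    simp only [PiLp.add_apply, PiLp.smul_apply, smul_eq_mul]
    calc _ ≤ t * c i + r * c i := add_le_add h1 h2
      _ = c i := by rw [← add_mul, htr, one_mul]
  have hUcl : IsClosed U := by
    rw [hU, Set.ofPred_forall]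
    exact isClosed_iInter fun i => isClosed_le (by fun_prop) continuous_const
  obtain ⟨f, r, hf1, hf2⟩ := geometric_hahn_banach_closed_point hUc hUcl hsU
  set y := (InnerProductSpace.toDual ℝ (Vec (Fin nb))).symm f
  have hfy : ∀ v, f v = ⟪v, y⟫ := fun v => by
    rw [real_inner_comm, InnerProductSpace.toDual_symm_apply]
  obtain ⟨⟨u, hu, hgu⟩, -⟩ := hC y
  have hlt : S.gbar y < ⟪s, y⟫ := by
    rw [hgu, ← hfy, ← hfy]; exact (hf1 u hu).trans hf2
  have key : ∀ t : ℝ, 0 ≤ t → t * (⟪s, y⟫ - S.gbar y) ≤ (conj S.gbar s).toReal := by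
    intro t ht
    have h1 := sub_le_conj hs (t • y)
    obtain ⟨⟨u', hu', hgu'⟩, -⟩ := hC (t • y)
    -- The maximizer `u'` for `t • y` competes at `y`, which gives `gbar (t • y) ≤ t * gbar y`.
    have h2 := mul_le_mul_of_nonneg_left ((hC y).2 ⟨u', hu', rfl⟩) ht
    rw [hgu', real_inner_smul_left, real_inner_smul_right, real_inner_comm] at h1
    linarith
  have hp : 0 < ⟪s, y⟫ - S.gbar y := by linarith
  have h3 := key ((|(conj S.gbar s).toReal| + 1) / (⟪s, y⟫ - S.gbar y)) (by positivity)
  rw [div_mul_cancel₀ _ hp.ne'] at h3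
  linarith [le_abs_self (conj S.gbar s).toReal]

omit hS in
lemma conj_eq_zero (hC : S.Polyhedral C c) {s : Vec (Fin nb)} (hs : conj S.gbar s < ⊤) :
    (conj S.gbar s).toReal = 0 := by
  refine le_antisymm (conj_le_of_forall_le fun y => ?_) ?_
  · have := (hC y).2 ⟨s, mem_polyhedron hC hs, rfl⟩
    rw [real_inner_comm]; linarith
  · obtain ⟨⟨u, -, hu⟩, -⟩ := hC 0
    have := sub_le_conj hs 0
    rw [hu, inner_zero_left, inner_zero_right, sub_zero] at this
    exact this

omit hS in
lemma violationSq_eq_zero (hC : S.Polyhedral C c) (hz : z ∈ S.dualDom) :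
    violationSq C c z = 0 := by
  refine Finset.sum_eq_zero fun i _ => ?_
  rw [max_eq_right (sub_nonpos.2 (mem_polyhedron hC hz i)), zero_pow two_ne_zero]

lemma shifted_sub_nu (hzs : zs ∈ S.Omega x) (z : Vec (Fin nb ⊕ Fin n)) :
    S.shifted x z - S.tau • S.nu x = lin S.M.transpose (z - zs) := by
  rw [hS.tau_smul_nu hzs, shifted_sub]

lemma dualMin_sub_nu (hC : S.Polyhedral C c) (hzs : zs ∈ S.Omega x) :
    (S.dualMin x).toReal - S.tau / 2 * ‖S.nu x‖ ^ 2 =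
      -⟪fstBlock zs, S.bbar⟫ - ⟪sndBlock zs, S.b⟫ := by
  have hτ := hS.tau_pos
  rw [hS.dualMin_eq hzs, EReal.toReal_coe, dualReal, conj_eq_zero hC (hS.Omega_subset hzs),
    dualQuad, ← hS.tau_smul_nu hzs, norm_smul, mul_pow, Real.norm_of_nonneg hτ.le]
  field_simp
  ring

lemma infDist_le_of_hoffmanSmall {θ : ℝ} (hC : S.Polyhedral C c) (hθ : S.IsHoffmanSmall C c θ)
    (hz : z ∈ S.dualDom) (hzs : zs ∈ S.Omega x) :
    Metric.infDist z (S.Omega x) ≤ θ * ‖lin S.M.transpose (z - zs)‖ := by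
  have h := hθ x z
  rwa [violationSq_eq_zero hC hz, add_zero, hS.shifted_sub_nu hzs,
    Real.sqrt_sq (norm_nonneg _)] at h

lemma infDist_le_of_hoffman {θ : ℝ} (hC : S.Polyhedral C c) (hθ : S.IsHoffman C c θ)
    (hz : z ∈ S.dualDom) (hzs : zs ∈ S.Omega x) :
    Metric.infDist z (S.Omega x) ≤ θ * Real.sqrt (‖lin S.M.transpose (z - zs)‖ ^ 2
      + (-⟪fstBlock (z - zs), S.bbar⟫ - ⟪sndBlock (z - zs), S.b⟫) ^ 2) := by
  have h := hθ x z
  have h1 := hS.dualMin_sub_nu hC hzs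
  have h2 : -⟪fstBlock z, S.bbar⟫ - ⟪sndBlock z, S.b⟫ - (S.dualMin x).toReal
      + S.tau / 2 * ‖S.nu x‖ ^ 2
      = -⟪fstBlock (z - zs), S.bbar⟫ - ⟪sndBlock (z - zs), S.b⟫ := by
    simp only [fstBlock_sub, sndBlock_sub, inner_sub_left]
    linarith
  rwa [violationSq_eq_zero hC hz, add_zero, hS.shifted_sub_nu hzs, h2] at h

lemma hoffmanSmall_pos {θ : ℝ} (hθ : S.IsHoffmanSmall C c θ) : 0 < θ := by
  obtain ⟨z, hz⟩ := hS.exists_notMem_Omega 0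
  exact pos_of_mul_pos_left ((hS.infDist_pos hz).trans_le (hθ 0 z)) (Real.sqrt_nonneg _)

lemma hoffman_pos {θ : ℝ} (hθ : S.IsHoffman C c θ) : 0 < θ := by
  obtain ⟨z, hz⟩ := hS.exists_notMem_Omega 0
  exact pos_of_mul_pos_left ((hS.infDist_pos hz).trans_le (hθ 0 z)) (Real.sqrt_nonneg _)

lemma growth_of_infDist_le {θ : ℝ} (hθ : 0 < θ) (hz : z ∈ S.dualDom) (hzs : zs ∈ S.Omega x)
    (h : Metric.infDist z (S.Omega x) ≤ θ * ‖lin S.M.transpose (z - zs)‖) :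
    (θ ^ 2 * S.tau)⁻¹ / 2 * Metric.infDist z (S.Omega x) ^ 2
      ≤ S.dualReal x z - S.dualReal x zs := by
  have hτ := hS.tau_pos
  have h1 := hS.growth_norm hzs hz
  have h2 := pow_le_pow_left₀ Metric.infDist_nonneg h 2
  calc _ ≤ (θ ^ 2 * S.tau)⁻¹ / 2 * (θ * ‖lin S.M.transpose (z - zs)‖) ^ 2 := by gcongr
    _ = 1 / (2 * S.tau) * ‖lin S.M.transpose (z - zs)‖ ^ 2 := by field_simp
    _ ≤ _ := by linarith

lemma hasGrowth_rho_of_hoffmanSmall {θ : ℝ} (hC : S.Polyhedral C c)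
    (hθ : S.IsHoffmanSmall C c θ) (hbb : S.bbar = 0) (hb : S.b = 0) (x : Vec (Fin d)) :
    S.HasGrowth (S.rho θ x) x := by
  intro z hz _ zs hzs
  rw [rho, if_pos ⟨hbb, hb⟩]
  exact hS.growth_of_infDist_le (hS.hoffmanSmall_pos hθ) hz hzs
    (hS.infDist_le_of_hoffmanSmall hC hθ hz hzs)

/-- Conjugate values vanish on the domain, so the gap is `G = ⟪ν, Mᵀ(z - zs)⟫ + r + e²/(2τ)`, and
the first two terms have nonnegative sum by optimality. Hence `e² ≤ 2τG` and `|r| ≤ G + ‖ν‖e`;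
squaring the latter gives the factor. -/
lemma offset_residual_sq_le (hC : S.Polyhedral C c) (hz : z ∈ S.dualDom)
    (hzs : zs ∈ S.Omega x) :
    ‖lin S.M.transpose (z - zs)‖ ^ 2
      + (-⟪fstBlock (z - zs), S.bbar⟫ - ⟪sndBlock (z - zs), S.b⟫) ^ 2 ≤
    2 * (S.dualReal x z - S.dualReal x zs) *
      (S.tau + (S.dualReal x z - S.dualReal x zs) + 2 * S.tau * ‖S.nu x‖ ^ 2) := by
  have hτ := hS.tau_pos
  set G := S.dualReal x z - S.dualReal x zs with hG
  set e := ‖lin S.M.transpose (z - zs)‖ with he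
  set r := -⟪fstBlock (z - zs), S.bbar⟫ - ⟪sndBlock (z - zs), S.b⟫ with hr
  have h1 := hS.growth_norm hzs hz
  have h2 := hS.first_order hzs hz
  have h3 := dualQuad_expand (S := S) x z zs
  have hz0 := conj_eq_zero hC hz
  have hzs0 := conj_eq_zero hC (hS.Omega_subset hzs)
  have h4 : ⟪S.dualGrad x zs, z - zs⟫ = ⟪S.nu x, lin S.M.transpose (z - zs)⟫ + r := by
    rw [dualGrad, ← hS.tau_smul_nu hzs, map_smul, smul_smul, one_div_mul_cancel hτ.ne', one_smul,
      inner_sub_left, real_inner_comm _ (S.nu x), inner_lin_transpose,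
      real_inner_comm (lin S.M (S.nu x)),
      inner_eq_blocks (stack _ _), fstBlock_stack, sndBlock_stack, hr,
      real_inner_comm S.bbar, real_inner_comm S.b]
    ring
  have h5 : G = ⟪S.dualGrad x zs, z - zs⟫ + 1 / (2 * S.tau) * e ^ 2 := by
    rw [hG, dualReal, dualReal, h3, hz0, hzs0]; ring
  rw [hz0, hzs0, sub_self, add_zero] at h2
  have h6 := abs_le.1 (abs_real_inner_le_norm (S.nu x) (lin S.M.transpose (z - zs)))
  have he2 : e ^ 2 ≤ 2 * S.tau * G := by
    have h7 : 1 / (2 * S.tau) * e ^ 2 ≤ G := by linarith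
    rw [one_div, inv_mul_le_iff₀ (by positivity)] at h7
    exact h7
  have hG0 : 0 ≤ G := by
    have : 0 ≤ 1 / (2 * S.tau) * e ^ 2 := by positivity
    linarith
  have he0 : 0 ≤ 1 / (2 * S.tau) * e ^ 2 := by positivity
  have hr2 : r ^ 2 ≤ (G + ‖S.nu x‖ * e) ^ 2 := by
    refine sq_le_sq' ?_ ?_ <;> linarith
  have h8 : (G + ‖S.nu x‖ * e) ^ 2 ≤ 2 * G ^ 2 + 2 * (‖S.nu x‖ ^ 2 * e ^ 2) := by
    nlinarith [sq_nonneg (G - ‖S.nu x‖ * e)]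
  have h9 := mul_le_mul_of_nonneg_left he2 (sq_nonneg ‖S.nu x‖)
  nlinarith

lemma rho_pos {θ : ℝ} (hθ : 0 < θ) (hini : S.bbar = 0 ∧ S.b = 0 ∨ S.zini ∈ S.dualDom)
    (x : Vec (Fin d)) : 0 < S.rho θ x := by
  have hτ := hS.tau_pos
  rw [rho]
  split_ifs with h
  · positivity
  · obtain ⟨zs, hzs⟩ := hS.Omega_nonempty x
    have hini := hini.resolve_left h
    rw [hS.gap_eq hzs hini]
    have := sub_nonneg.2 ((hS.mem_Omega_iff.1 hzs).2 _ hini)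
    positivity

lemma hasGrowth_rho_of_hoffman {θ : ℝ} (hC : S.Polyhedral C c)
    (hθ : S.IsHoffman C c θ) (hini : S.zini ∈ S.dualDom) (x : Vec (Fin d)) :
    S.HasGrowth (S.rho θ x) x := by
  intro z hz hz' zs hzs
  have hτ := hS.tau_pos
  have hθ0 := hS.hoffman_pos hθ
  have h1 := hS.infDist_le_of_hoffman hC hθ hz hzs
  rw [rho]
  split_ifs with h
  · refine hS.growth_of_infDist_le hθ0 hz hzs (h1.trans_eq ?_)
    rw [h.1, h.2, inner_zero_right, inner_zero_right, neg_zero, sub_zero, zero_pow two_ne_zero,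
      add_zero, Real.sqrt_sq (norm_nonneg _)]
  · have h2 := hS.offset_residual_sq_le hC hz hzs
    have h3 := hz' hini
    have h4 := sub_nonneg.2 ((hS.mem_Omega_iff.1 hzs).2 _ hz)
    rw [hS.gap_eq hzs hini]
    set G := S.dualReal x z - S.dualReal x zs
    set K := S.dualReal x S.zini - S.dualReal x zs
    -- The factor of `offset_residual_sq_le` depends on the gap itself; on the sublevel set of
    -- `zini` it is bounded by its value at the start, which is what `rho` contains.
    have hK : G ≤ K := sub_le_sub_right h3 _
    have hK0 : 0 < S.tau + K + 2 * S.tau * ‖S.nu x‖ ^ 2 := by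
      have : 0 ≤ 2 * S.tau * ‖S.nu x‖ ^ 2 := by positivity
      linarith
    have h5 := pow_le_pow_left₀ Metric.infDist_nonneg h1 2
    rw [mul_pow, Real.sq_sqrt (by positivity)] at h5
    rw [div_mul_eq_mul_div, div_le_iff₀ two_pos, inv_mul_le_iff₀ (by positivity)]
    calc _ ≤ θ ^ 2 * (2 * G * (S.tau + G + 2 * S.tau * ‖S.nu x‖ ^ 2)) :=
          h5.trans (mul_le_mul_of_nonneg_left h2 (sq_nonneg _))
      _ ≤ θ ^ 2 * (2 * G * (S.tau + K + 2 * S.tau * ‖S.nu x‖ ^ 2)) := by gcongr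
      _ = _ := by ring

end Polyhedral

end StandingAssumptions
end Setup

/-! ### The outer iteration: stationarity, descent, and the choice of tolerance. -/

lemma norm_lin_transpose_le {ι κ : Type} [Fintype ι] [Fintype κ] [DecidableEq ι] [DecidableEq κ]
    (A : Matrix ι κ ℝ) (z : Vec ι) : ‖lin A.transpose z‖ ≤ ‖lin A‖ * ‖z‖ := by
  have h1 : ‖lin A.transpose z‖ ^ 2 ≤ ‖z‖ * (‖lin A‖ * ‖lin A.transpose z‖) := by
    rw [← real_inner_self_eq_norm_sq, inner_lin_transpose]
    exact (real_inner_le_norm _ _).trans (by gcongr; exact ContinuousLinearMap.le_opNorm _ _)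
  rcases (norm_nonneg (lin A.transpose z)).eq_or_lt with h | h
  · rw [← h]; positivity
  · refine le_of_mul_le_mul_right ?_ h
    nlinarith

namespace Setup

variable {d n nb : ℕ} {S : Setup d n nb} {x : Vec (Fin d)} {z zs : Vec (Fin nb ⊕ Fin n)}

lemma exactPoint_eq (hτ : 0 < S.tau) (x : Vec (Fin d)) (z : Vec (Fin nb ⊕ Fin n)) :
    S.exactPoint x z = S.xUpdate x z := by
  rw [exactPoint, xUpdate, shifted, smul_sub, smul_smul, one_div_mul_cancel hτ.ne', one_smul]
  abel

lemma lin_M_transpose_eq (hτ : 0 < S.tau) (x : Vec (Fin d)) (z : Vec (Fin nb ⊕ Fin n)) :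
    lin S.M.transpose z = -(gradient S.f0 x + S.tau • (S.exactPoint x z - x)) := by
  rw [exactPoint, smul_sub, smul_neg, smul_smul, mul_one_div_cancel hτ.ne', one_smul, shifted]
  abel

lemma xIter_succ (ρ : Vec (Fin d) → ℝ) (δ : ℝ) (k : ℕ) :
    S.xIter ρ δ (k + 1) = S.xUpdate (S.xIter ρ δ k)
      (S.nextZ (ρ (S.xIter ρ δ k)) δ (S.xIter ρ δ k)) := rfl

namespace StandingAssumptions

variable (hS : S.StandingAssumptions)
include hS

lemma subdiff_g (hzs : zs ∈ S.Omega x) :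
    lin S.Abar.transpose (fstBlock zs) ∈ subdiff S.g (S.exactPoint x zs) := by
  intro x'
  have h := hS.fstBlock_mem_subdiff hzs (lin S.Abar x' + S.bbar)
  rw [inner_lin_transpose, map_sub]
  rwa [add_sub_add_right_eq_sub] at h

/-- With the multiplier `sndBlock zs` and the subgradient from `subdiff_g`, the residual is `∇f₀(u)
- ∇f₀(x) - τ(u - x)`, which costs `L_f + τ = 3 L_f` per unit of `‖u - x‖`. -/
lemma isStationary_exactPoint {ε : ℝ} (hε : 0 ≤ ε) (hzs : zs ∈ S.Omega x)
    (h : 3 * S.Lf * ‖S.exactPoint x zs - x‖ ≤ ε) : S.IsStationary ε (S.exactPoint x zs) := by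
  have hL := hS.Lf_pos
  refine ⟨sndBlock zs, ?_, by rw [hS.exactPoint_feasible hzs, norm_zero]; exact hε⟩
  refine (Metric.infEDist_le_edist_of_mem
    (Set.mem_image_of_mem _ (hS.subdiff_g hzs))).trans ?_
  rw [edist_comm, edist_dist, dist_zero_right]
  refine ENNReal.ofReal_le_ofReal (le_trans ?_ h)
  set u := S.exactPoint x zs with hu
  have h1 : gradient S.f0 u + lin S.A.transpose (sndBlock zs)
      + lin S.Abar.transpose (fstBlock zs)
      = (gradient S.f0 u - gradient S.f0 x) - S.tau • (u - x) := by
    have h2 := lin_M_transpose_eq hS.tau_pos x zs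
    rw [lin_M_transpose, ← hu] at h2
    rw [add_assoc, add_comm (lin S.A.transpose _), h2]
    abel
  rw [h1]
  refine (norm_sub_le _ _).trans ?_
  rw [norm_smul, Real.norm_of_nonneg hS.tau_pos.le, tau]
  linarith [hS.gradient_lipschitz u x]

/-- Test the subgradient inequality for `g` at `u` with the feasible point `v`; the multiplier term
vanishes because `A(v - u) = 0`. Adding the descent lemma from `v`, the choice `τ = 2 L_f` makes the
terms in `‖v - u‖²` cancel exactly. -/
lemma descent (hzs : zs ∈ S.Omega x) {v : Vec (Fin d)} (hv : lin S.A v + S.b = 0) :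
    S.Lf * ‖S.exactPoint x zs - x‖ ^ 2 ≤
      S.F0 v - S.F0 (S.exactPoint x zs) + 3 / 2 * S.Lf * ‖x - v‖ ^ 2 := by
  have hL := hS.Lf_pos
  set u := S.exactPoint x zs with hu
  have h1 := hS.subdiff_g hzs v
  have h2 : ⟪lin S.Abar.transpose (fstBlock zs), v - u⟫
      = -⟪gradient S.f0 x, v - u⟫ - S.tau * ⟪u - x, v - u⟫ := by
    have h3 : ⟪lin S.A.transpose (sndBlock zs), v - u⟫ = 0 := by
      have h4 : lin S.A v - lin S.A u = 0 := by
        rw [← add_sub_add_right_eq_sub _ _ S.b, hv, hS.exactPoint_feasible hzs, sub_zero]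
      rw [inner_lin_transpose, map_sub, h4, inner_zero_right]
    have h5 : lin S.Abar.transpose (fstBlock zs)
        = lin S.M.transpose zs - lin S.A.transpose (sndBlock zs) := by
      rw [lin_M_transpose]; abel
    rw [h5, inner_sub_left, h3, lin_M_transpose_eq hS.tau_pos x zs, inner_neg_left,
      inner_add_left, real_inner_smul_left]
    ring
  rw [← hu, h2] at h1
  have h6 := descent_lemma hS.differentiable hS.gradient_lipschitz v u
  have h7 : ⟪gradient S.f0 v, u - v⟫ + ⟪gradient S.f0 x, v - u⟫
      ≤ S.Lf * ‖x - v‖ * ‖v - u‖ := by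
    have h8 : ⟪gradient S.f0 v, u - v⟫ + ⟪gradient S.f0 x, v - u⟫
        = ⟪gradient S.f0 x - gradient S.f0 v, v - u⟫ := by
      rw [← neg_sub v u, inner_neg_right, inner_sub_left]; ring
    rw [h8]
    exact (real_inner_le_norm _ _).trans
      (mul_le_mul_of_nonneg_right (hS.gradient_lipschitz x v) (norm_nonneg _))
  have h9 : ‖x - v‖ ^ 2 = ‖u - x‖ ^ 2 + 2 * ⟪u - x, v - u⟫ + ‖v - u‖ ^ 2 := by
    rw [← norm_add_sq_real, norm_sub_rev, sub_add_sub_comm, add_comm u v, add_sub_add_right_eq_sub]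
  have h10 : ‖u - v‖ = ‖v - u‖ := norm_sub_rev _ _
  rw [h10] at h6
  rw [tau] at h1
  simp only [F0]
  have h11 : S.Lf * ‖x - v‖ * ‖v - u‖ ≤ S.Lf / 2 * (‖x - v‖ ^ 2 + ‖v - u‖ ^ 2) := by
    nlinarith [mul_nonneg hL.le (sq_nonneg (‖x - v‖ - ‖v - u‖))]
  have h12 : S.Lf * ‖x - v‖ ^ 2
      = S.Lf * ‖u - x‖ ^ 2 + 2 * S.Lf * ⟪u - x, v - u⟫ + S.Lf * ‖v - u‖ ^ 2 := by
    rw [h9]; ring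
  linarith

lemma Delta_ge (v : Vec (Fin d)) : S.F0 S.x0 - S.F0 v ≤ S.Delta :=
  sub_le_sub_left (ciInf_le hS.F0_bddBelow v) _

/-- The iterates themselves need not be feasible. The sequence `v` consists of the exact steps taken
from the inexact centers, starting at `x0`. -/
lemma exists_exact_sequence {ρ : Vec (Fin d) → ℝ} {δ : ℝ} (hδ : 0 ≤ δ)
    (hacc : ∀ k, S.Accept (S.xIter ρ δ k) δ
      (S.nextZ (ρ (S.xIter ρ δ k)) δ (S.xIter ρ δ k))) :
    ∃ v : ℕ → Vec (Fin d), v 0 = S.x0 ∧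
      (∀ k, ∃ zs ∈ S.Omega (S.xIter ρ δ k), v (k + 1) = S.exactPoint (S.xIter ρ δ k) zs) ∧
      (∀ k, ‖S.xIter ρ δ k - v k‖ ≤ ‖lin S.M‖ * δ / S.tau) ∧
      ∀ k, lin S.A (v k) + S.b = 0 := by
  have hτ := hS.tau_pos
  have h : ∀ k, ∃ zs ∈ S.Omega (S.xIter ρ δ k),
      ‖S.nextZ (ρ (S.xIter ρ δ k)) δ (S.xIter ρ δ k) - zs‖ ≤ δ := by
    intro k
    obtain ⟨zs, hzs, hd⟩ := hS.exists_dist_eq (S.xIter ρ δ k)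
      (S.nextZ (ρ (S.xIter ρ δ k)) δ (S.xIter ρ δ k))
    exact ⟨zs, hzs, hd.trans_le (ENNReal.toReal_le_of_le_ofReal hδ (hacc k).2)⟩
  choose zs hzs hd using h
  refine ⟨fun k => Nat.casesOn k S.x0 fun k => S.exactPoint (S.xIter ρ δ k) (zs k), rfl,
    fun k => ⟨zs k, hzs k, rfl⟩, fun k => ?_, fun k => ?_⟩
  · cases k with
    | zero =>
      change ‖S.x0 - S.x0‖ ≤ _
      rw [sub_self, norm_zero]; positivity
    | succ k =>
      change ‖_ - S.exactPoint _ _‖ ≤ _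
      rw [xIter_succ, exactPoint_eq hτ]
      have h1 : S.xUpdate (S.xIter ρ δ k) (S.nextZ (ρ (S.xIter ρ δ k)) δ (S.xIter ρ δ k))
          - S.xUpdate (S.xIter ρ δ k) (zs k) = -((1 / S.tau) • lin S.M.transpose
            (S.nextZ (ρ (S.xIter ρ δ k)) δ (S.xIter ρ δ k) - zs k)) := by
        rw [xUpdate, xUpdate, map_sub]; module
      rw [h1, norm_neg, norm_smul, Real.norm_of_nonneg (by positivity), one_div,
        inv_mul_le_iff₀ hτ, mul_div_cancel₀ _ hτ.ne']
      exact (norm_lin_transpose_le _ _).trans (by gcongr; exact hd k)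
  · cases k with
    | zero => exact hS.feasible
    | succ k => exact hS.exactPoint_feasible (hzs k)

/-! ### The tolerance -/

lemma norm_M_pos : 0 < ‖lin S.M‖ := by
  obtain ⟨v, hv⟩ := lin_ne_zero hS.M_ne_zero
  refine norm_pos_iff.2 fun h => hv ?_
  rw [h]; rfl

lemma lf_nonneg : 0 ≤ S.lf := by
  obtain ⟨v, hv⟩ := lin_ne_zero hS.M_ne_zero
  have hv0 : v ≠ 0 := fun h => hv (by rw [h, map_zero])
  have h := (abs_nonneg _).trans (hS.f0_lipschitz v 0)
  rw [sub_zero] at h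
  exact nonneg_of_mul_nonneg_left h (norm_pos_iff.2 hv0)

lemma B1_pos : 0 < S.B1 := by
  have hτ := hS.tau_pos
  have hσ := hS.sigma_pos
  rw [B1]; positivity

lemma B_sum_pos : 0 < S.B2 + S.sigma * ‖lin S.Abar‖ * S.B4 + S.lg := by
  have hτ := hS.tau_pos
  have hσ := hS.sigma_pos
  have hlg := hS.lg_pos
  have hlf := hS.lf_nonneg
  have hp : 0 ≤ S.pinvNorm := norm_nonneg _
  have hB2 : 0 ≤ S.B2 := by rw [B2]; positivity
  have hB4 : 0 ≤ S.B4 := by rw [B4]; positivity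
  positivity

lemma B3_pos : 0 < S.B3 := by
  have hp : 0 ≤ S.pinvNorm := norm_nonneg _
  rw [B3]; positivity

lemma deltaBar_pos {ε : ℝ} (hε : 0 < ε) : 0 < S.deltaBar ε := by
  have := hS.tau_pos
  have := hS.sigma_pos
  have := hS.lg_pos
  have := hS.Lf_pos
  have := hS.B1_pos
  have := hS.B_sum_pos
  have := hS.B3_pos
  have := hS.norm_M_pos
  have := hS.Delta_pos
  rw [deltaBar, delta]
  refine lt_min (lt_min ?_ ?_) (lt_min (lt_min ?_ ?_) (lt_min ?_ ?_)) <;> positivity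

/-- Every entry of the minimum is constant, linear or quadratic in `ε`, the square root being
linear; for `ε ≤ 1` each dominates `ε²` times its value at `1`. -/
lemma deltaBar_ge {ε : ℝ} (hε : 0 < ε) (hε1 : ε ≤ 1) :
    S.deltaBar 1 * ε ^ 2 ≤ S.deltaBar ε := by
  have := hS.tau_pos
  have := hS.sigma_pos
  have := hS.lg_pos
  have := hS.Lf_pos
  have := hS.B1_pos
  have := hS.B_sum_pos
  have := hS.B3_pos
  have := hS.norm_M_pos
  have := hS.Delta_pos
  have hsq : ε ^ 2 ≤ ε := by nlinarith
  have hlin : ∀ a : ℝ, 0 < a → 1 / a * ε ^ 2 ≤ ε / a := by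
    intro a ha
    rw [one_div_mul_eq_div]; gcongr
  have key : ∀ a b : ℝ, S.deltaBar 1 ≤ a → a * ε ^ 2 ≤ b → S.deltaBar 1 * ε ^ 2 ≤ b :=
    fun a b h1 h2 => (mul_le_mul_of_nonneg_right h1 (sq_nonneg ε)).trans h2
  rw [show S.deltaBar ε = _ from rfl, deltaBar, delta]
  refine le_min (le_min ?_ ?_) (le_min (le_min ?_ ?_) (le_min ?_ ?_))
  · exact key _ _ ((min_le_left _ _).trans (min_le_left _ _)) (hlin _ (by positivity))
  · refine key _ _ ((min_le_left _ _).trans (min_le_right _ _))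
      (mul_le_of_le_one_right (by positivity) (by nlinarith))
  · exact key _ _ ((min_le_right _ _).trans ((min_le_left _ _).trans (min_le_left _ _)))
      (hlin _ (by positivity))
  · exact key _ _ ((min_le_right _ _).trans ((min_le_left _ _).trans (min_le_right _ _)))
      (hlin _ (by positivity))
  · refine key _ _ ((min_le_right _ _).trans ((min_le_right _ _).trans (min_le_left _ _)))
      (le_of_eq ?_)
    rw [one_pow, one_div_mul_eq_div]
  · refine key _ _ ((min_le_right _ _).trans ((min_le_right _ _).trans (min_le_right _ _))) ?_
    rw [one_pow, Real.sqrt_div (sq_nonneg ε), Real.sqrt_sq hε.le, Real.sqrt_div zero_le_one,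
      Real.sqrt_one]
    exact hlin _ (by positivity)

lemma step_error_le {ε : ℝ} : ‖lin S.M‖ * S.deltaBar ε / S.tau ≤ ε / (12 * S.Lf) := by
  have hM := hS.norm_M_pos
  have hL := hS.Lf_pos
  have h1 : S.deltaBar ε ≤ ε / (6 * ‖lin S.M‖) := (min_le_left _ _).trans (min_le_left _ _)
  have h2 : ‖lin S.M‖ * S.deltaBar ε / S.tau ≤ ‖lin S.M‖ * (ε / (6 * ‖lin S.M‖)) / S.tau := by
    have := hS.tau_pos
    gcongr
  refine h2.trans_eq ?_
  rw [tau]; field_simp; ring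

lemma Kbar_pos {ε : ℝ} (hε : 0 < ε) : 0 < S.Kbar ε := by
  have := hS.Lf_pos
  have := hS.Delta_pos
  exact Nat.ceil_pos.2 (by positivity)

/-! ### Progress of the outer iterations -/

lemma sum_steps_le {ρ : Vec (Fin d) → ℝ} {δ η : ℝ} {v : ℕ → Vec (Fin d)} (h0 : v 0 = S.x0)
    (hv : ∀ k, ∃ zs ∈ S.Omega (S.xIter ρ δ k), v (k + 1) = S.exactPoint (S.xIter ρ δ k) zs)
    (hη : ∀ k, ‖S.xIter ρ δ k - v k‖ ≤ η) (hfeas : ∀ k, lin S.A (v k) + S.b = 0) (K : ℕ) :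
    S.Lf * ∑ k ∈ Finset.range K, ‖v (k + 1) - S.xIter ρ δ k‖ ^ 2 ≤
      S.Delta + K * (3 / 2 * S.Lf * η ^ 2) := by
  have hL := hS.Lf_pos
  have h : S.Lf * ∑ k ∈ Finset.range K, ‖v (k + 1) - S.xIter ρ δ k‖ ^ 2 ≤
      S.F0 (v 0) - S.F0 (v K) + K * (3 / 2 * S.Lf * η ^ 2) := by
    induction K with
    | zero => simp
    | succ K ih =>
      obtain ⟨zs, hzs, hvK⟩ := hv K
      have h1 := hS.descent hzs (hfeas K)
      rw [← hvK] at h1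
      have h2 : 3 / 2 * S.Lf * ‖S.xIter ρ δ K - v K‖ ^ 2 ≤ 3 / 2 * S.Lf * η ^ 2 := by
        gcongr; exact hη K
      rw [Finset.sum_range_succ, mul_add]
      push_cast
      linarith
  rw [h0] at h
  linarith [hS.Delta_ge (v K)]

lemma findsNearStationary {ρ : Vec (Fin d) → ℝ} (hρ : ∀ x, 0 < ρ x)
    (hg : ∀ x, S.HasGrowth (ρ x) x) {ε : ℝ} (hε : 0 < ε) : S.FindsNearStationary ρ ε := by
  have hL := hS.Lf_pos
  have hδ := hS.deltaBar_pos hε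
  have hacc : ∀ k, S.Accept (S.xIter ρ (S.deltaBar ε) k) (S.deltaBar ε)
      (S.nextZ (ρ (S.xIter ρ (S.deltaBar ε) k)) (S.deltaBar ε) (S.xIter ρ (S.deltaBar ε) k)) :=
    fun k => hS.accept_nextZ (hρ _) hδ (hg _)
  refine ⟨hacc, hS.Kbar_pos hε, fun k' hk' hmin => ?_⟩
  obtain ⟨v, h0, hv, hη, hfeas⟩ := hS.exists_exact_sequence hδ.le hacc
  replace hη := fun k => (hη k).trans hS.step_error_le
  set x := S.xIter ρ (S.deltaBar ε)
  set K := S.Kbar ε with hK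
  have hKpos : (0 : ℝ) < K := by exact_mod_cast hS.Kbar_pos hε
  -- If all exact steps exceeded `ε/(8 L_f)`, telescoping would give `Kε²/(64 L_f) < Δ + Kε²/(96
  -- L_f)`. This contradicts `Δ ≤ Kε²/(192 L_f)`, since `1/64 = 1/192 + 1/96`.
  obtain ⟨k, hkK, hk⟩ : ∃ k < K, ‖v (k + 1) - x k‖ ≤ ε / (8 * S.Lf) := by
    by_contra! hcon
    have h1 := hS.sum_steps_le h0 hv hη hfeas K
    have h2 : (K : ℝ) * (ε / (8 * S.Lf)) ^ 2 < ∑ k ∈ Finset.range K, ‖v (k + 1) - x k‖ ^ 2 := by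
      have h3 : ∑ _k ∈ Finset.range K, (ε / (8 * S.Lf)) ^ 2
          < ∑ k ∈ Finset.range K, ‖v (k + 1) - x k‖ ^ 2 :=
        Finset.sum_lt_sum_of_nonempty (Finset.nonempty_range_iff.2 (hS.Kbar_pos hε).ne')
          fun k hk => pow_lt_pow_left₀ (hcon k (Finset.mem_range.1 hk)) (by positivity) two_ne_zero
      simpa using h3
    have h4 : 192 * S.Lf * S.Delta / ε ^ 2 ≤ K := Nat.le_ceil _
    rw [div_le_iff₀ (by positivity)] at h4
    have h5 := mul_lt_mul_of_pos_left h2 hL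
    have h6 := h5.trans_le h1
    have h7 : S.Lf * (K * (ε / (8 * S.Lf)) ^ 2) = K * ε ^ 2 / (64 * S.Lf) := by
      field_simp; norm_num
    have h8 : K * (3 / 2 * S.Lf * (ε / (12 * S.Lf)) ^ 2) = K * ε ^ 2 / (96 * S.Lf) := by
      field_simp; norm_num
    have h9 : S.Delta ≤ K * ε ^ 2 / (192 * S.Lf) := by
      rw [le_div_iff₀ (by positivity)]; linarith
    have h10 : K * ε ^ 2 / (64 * S.Lf) = K * ε ^ 2 / (192 * S.Lf) + K * ε ^ 2 / (96 * S.Lf) := by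
      field_simp; norm_num
    rw [h7, h8] at h6
    linarith
  obtain ⟨zs, hzs, hvk⟩ := hv k'
  have e1 : ‖x (k + 1) - x k‖ ≤ ε / (12 * S.Lf) + ε / (8 * S.Lf) :=
    (norm_sub_le_norm_sub_add_norm_sub _ (v (k + 1)) _).trans (add_le_add (hη _) hk)
  have e2 := (hmin k hkK).trans e1
  have e3 : ‖v (k' + 1) - x k'‖ ≤ ‖x (k' + 1) - v (k' + 1)‖ + ‖x (k' + 1) - x k'‖ := by
    rw [norm_sub_rev (x (k' + 1)) (v (k' + 1))]
    exact norm_sub_le_norm_sub_add_norm_sub _ _ _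
  have e4 := hη (k' + 1)
  refine ⟨v (k' + 1), ?_, e4⟩
  rw [hvk]
  refine hS.isStationary_exactPoint hε.le hzs ?_
  rw [← hvk]
  -- Here `7/24 = 1/12 + 1/12 + 1/8`: two displacements and the short exact step at `k`.
  have e5 : ‖v (k' + 1) - x k'‖ ≤ 7 / 24 * (ε / S.Lf) := by
    refine (e3.trans (add_le_add e4 e2)).trans_eq ?_
    field_simp; norm_num
  calc 3 * S.Lf * ‖v (k' + 1) - x k'‖ ≤ 3 * S.Lf * (7 / 24 * (ε / S.Lf)) := by gcongr
    _ = 7 / 8 * ε := by field_simp; norm_num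
    _ ≤ ε := by linarith

lemma Kbar_le {ε : ℝ} (hε : 0 < ε) (hε1 : ε ≤ 1) :
    (S.Kbar ε : ℝ) ≤ (192 * S.Lf * S.Delta + 1) / ε ^ 2 := by
  have hL := hS.Lf_pos
  have hD := hS.Delta_pos
  have h1 : (S.Kbar ε : ℝ) < 192 * S.Lf * S.Delta / ε ^ 2 + 1 := Nat.ceil_lt_add_one (by positivity)
  rw [add_div]
  have h2 : 1 ≤ 1 / ε ^ 2 := by
    rw [le_div_iff₀ (by positivity)]; nlinarith
  linarith

/-- Since `Kbar ε * ε²` is bounded, so is the accumulated error, and with it every single step,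
uniformly in `ε ≤ 1` and `ρ`. The `O(ε⁻²)` steps then add up. -/
lemma exists_iterate_bound : ∃ c : ℝ, 0 ≤ c ∧ ∀ (ρ : Vec (Fin d) → ℝ) (ε : ℝ), 0 < ε → ε ≤ 1 →
    (∀ x, 0 < ρ x) → (∀ x, S.HasGrowth (ρ x) x) → ∀ k < S.Kbar ε,
      ‖S.xIter ρ (S.deltaBar ε) k - S.x0‖ ≤ c / ε ^ 2 := by
  have hL := hS.Lf_pos
  have hD := hS.Delta_pos
  set κ := 192 * S.Lf * S.Delta + 1 with hκ
  set W := (S.Delta + κ * (3 / 2 * S.Lf * (1 / (12 * S.Lf)) ^ 2)) / S.Lf with hW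
  have hκ0 : 0 < κ := by positivity
  have hW0 : 0 ≤ W := by positivity
  refine ⟨κ * (1 / (12 * S.Lf) + Real.sqrt W), by positivity, fun ρ ε hε hε1 hρ hg k hk => ?_⟩
  have hδ := hS.deltaBar_pos hε
  obtain ⟨v, h0, hv, hη, hfeas⟩ := hS.exists_exact_sequence (ρ := ρ) hδ.le
    (fun k => hS.accept_nextZ (hρ _) hδ (hg _))
  replace hη := fun k => (hη k).trans hS.step_error_le
  have hsum := hS.sum_steps_le h0 hv hη hfeas (S.Kbar ε)
  set x := S.xIter ρ (S.deltaBar ε)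
  have hKle := hS.Kbar_le hε hε1
  have hstep : ∀ k < S.Kbar ε, ‖x (k + 1) - x k‖ ≤ 1 / (12 * S.Lf) + Real.sqrt W := by
    intro k hk
    have h1 : ‖v (k + 1) - x k‖ ^ 2 ≤ W := by
      have h2 : ‖v (k + 1) - x k‖ ^ 2 ≤ ∑ k ∈ Finset.range (S.Kbar ε), ‖v (k + 1) - x k‖ ^ 2 :=
        Finset.single_le_sum (f := fun k => ‖v (k + 1) - x k‖ ^ 2) (fun _ _ => sq_nonneg _)
          (Finset.mem_range.2 hk)
      rw [hW, le_div_iff₀ hL, mul_comm]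
      refine ((mul_le_mul_of_nonneg_left h2 hL.le).trans hsum).trans ?_
      have h3 : (S.Kbar ε : ℝ) * (3 / 2 * S.Lf * (ε / (12 * S.Lf)) ^ 2)
          ≤ κ / ε ^ 2 * (3 / 2 * S.Lf * (ε / (12 * S.Lf)) ^ 2) := by gcongr
      have h4 : κ / ε ^ 2 * (3 / 2 * S.Lf * (ε / (12 * S.Lf)) ^ 2)
          = κ * (3 / 2 * S.Lf * (1 / (12 * S.Lf)) ^ 2) := by field_simp
      linarith
    have h5 : ε / (12 * S.Lf) ≤ 1 / (12 * S.Lf) := by gcongr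
    exact (norm_sub_le_norm_sub_add_norm_sub _ (v (k + 1)) _).trans
      (add_le_add ((hη _).trans h5) (Real.le_sqrt_of_sq_le h1))
  have hlin : ∀ k ≤ S.Kbar ε, ‖x k - S.x0‖ ≤ k * (1 / (12 * S.Lf) + Real.sqrt W) := by
    intro k
    induction k with
    | zero =>
      intro _
      change ‖S.x0 - S.x0‖ ≤ _
      simp
    | succ k ih =>
      intro hk
      have h1 := norm_sub_le_norm_sub_add_norm_sub (x (k + 1)) (x k) S.x0
      have h2 := ih (Nat.le_of_succ_le hk)
      have h3 := hstep k hk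
      push_cast
      linarith
  refine (hlin k hk.le).trans ?_
  have h6 : (k : ℝ) ≤ S.Kbar ε := by exact_mod_cast hk.le
  rw [mul_div_right_comm]
  exact mul_le_mul_of_nonneg_right (h6.trans hKle) (by positivity)

end StandingAssumptions
end Setup

/-! ### Counting the inner steps. -/

lemma exists_ceil_logb_le {P X : ℝ} (hP : 0 < P) (hX : 0 < X) :
    ∃ ε₀ : ℝ, 0 < ε₀ ∧ ∀ ε : ℝ, 0 < ε → ε < ε₀ →
      (⌈Real.logb 2 (P / ε ^ 8)⌉₊ : ℝ) + 1 ≤ 13 * Real.log (X / ε) := by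
  set Q := |Real.log (P / X ^ 8)| with hQ
  -- This threshold means `L > 2Q + 2`. As `8/log 2 < 11.6`, the remaining `1.4 L` absorbs `3Q/2`
  -- and the two units from the ceiling and the extra loop.
  refine ⟨X * Real.exp (-(2 * Q + 2)), by positivity, fun ε hε hε0 => ?_⟩
  set L := Real.log (X / ε) with hL
  have hQ0 : 0 ≤ Q := abs_nonneg _
  have hLT : 2 * Q + 2 < L := by
    rw [hL, Real.lt_log_iff_exp_lt (by positivity), lt_div_iff₀ hε]
    rw [Real.exp_neg, ← div_eq_mul_inv, lt_div_iff₀ (Real.exp_pos _)] at hε0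
    linarith
  have h1 : Real.log (P / ε ^ 8) = Real.log (P / X ^ 8) + 8 * L := by
    have h2 : P / ε ^ 8 = P / X ^ 8 * (X / ε) ^ 8 := by field_simp
    rw [h2, Real.log_mul (by positivity) (by positivity), Real.log_pow]
    norm_num [hL]
  have hlog2 := Real.log_two_gt_d9
  have h3 : Real.logb 2 (P / ε ^ 8) ≤ 3 / 2 * Q + 116 / 10 * L := by
    rw [Real.logb, h1, div_le_iff₀ (by linarith)]
    have := le_abs_self (Real.log (P / X ^ 8))
    nlinarith
  have h4 : (⌈Real.logb 2 (P / ε ^ 8)⌉₊ : ℝ) ≤ 3 / 2 * Q + 116 / 10 * L + 1 := by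
    refine (Nat.cast_le.2 (Nat.ceil_mono h3)).trans ?_
    exact (Nat.ceil_lt_add_one (by linarith)).le
  linarith

namespace Setup

variable {d n nb : ℕ} {S : Setup d n nb} {x : Vec (Fin d)} {z zs : Vec (Fin nb ⊕ Fin n)}

lemma totalSteps_le {ρ : Vec (Fin d) → ℝ} {δ I J : ℝ} {K : ℕ} (hI0 : 0 ≤ I)
    (hI : ∀ k < K, (S.loopCount (ρ (S.xIter ρ δ k)) δ (S.xIter ρ δ k) : ℝ) ≤ I)
    (hJ : ∀ k < K, (S.loopLength (ρ (S.xIter ρ δ k)) : ℝ) ≤ J) :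
    (S.totalSteps ρ δ K : ℝ) ≤ K * (I * J) := by
  rw [totalSteps]
  push_cast
  refine (Finset.sum_le_card_nsmul _ _ (I * J) fun k hk => ?_).trans_eq (by simp)
  exact mul_le_mul (hI k (Finset.mem_range.1 hk)) (hJ k (Finset.mem_range.1 hk))
    (Nat.cast_nonneg _) hI0

namespace StandingAssumptions

variable (hS : S.StandingAssumptions)
include hS

lemma Kbar_le_of_small {ε : ℝ} (hε : 0 < ε) (hε1 : ε ≤ Real.sqrt (192 * S.Lf * S.Delta)) :
    (S.Kbar ε : ℝ) ≤ 384 * (S.Lf * S.Delta / ε ^ 2) := by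
  have hL := hS.Lf_pos
  have hD := hS.Delta_pos
  have h1 : (S.Kbar ε : ℝ) < 192 * S.Lf * S.Delta / ε ^ 2 + 1 :=
    Nat.ceil_lt_add_one (by positivity)
  have h2 : 1 ≤ 192 * S.Lf * S.Delta / ε ^ 2 := by
    rw [le_div_iff₀ (by positivity), one_mul]
    exact (Real.le_sqrt hε.le (by positivity)).1 hε1
  have h3 : 384 * (S.Lf * S.Delta / ε ^ 2) = 2 * (192 * S.Lf * S.Delta / ε ^ 2) := by ring
  linarith

lemma loopLength_le {ρ s : ℝ} (hs : 1 ≤ s) (h : S.LD / ρ ≤ s ^ 2) :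
    (S.loopLength ρ : ℝ) ≤ 4 * s := by
  have h1 : Real.sqrt (2 * S.LD / ρ) ≤ 3 / 2 * s := by
    refine Real.sqrt_le_iff.2 ⟨by positivity, ?_⟩
    rw [mul_div_assoc]
    nlinarith
  have h2 : (S.loopLength ρ : ℝ) < 2 * Real.sqrt (2 * S.LD / ρ) + 1 :=
    Nat.ceil_lt_add_one (by positivity)
  linarith

lemma norm_gradient_sub_le (x : Vec (Fin d)) (v : Vec (Fin d)) :
    ‖v + gradient S.f0 x - S.tau • x + S.tau • S.x0‖ ≤
      ‖v + gradient S.f0 S.x0‖ + 3 * S.Lf * ‖x - S.x0‖ := by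
  have h1 : v + gradient S.f0 x - S.tau • x + S.tau • S.x0 = (v + gradient S.f0 S.x0)
      + ((gradient S.f0 x - gradient S.f0 S.x0) - S.tau • (x - S.x0)) := by module
  rw [h1]
  refine (norm_add_le _ _).trans (add_le_add le_rfl ((norm_sub_le _ _).trans ?_))
  rw [norm_smul, Real.norm_of_nonneg hS.tau_pos.le, tau]
  linarith [hS.gradient_lipschitz x S.x0]

/-- In `dualReal_sub_le` the center enters only through a square whose base is Lipschitz in `x`, so
the gap at a fixed `z` grows at most quadratically in `‖x - x0‖`. -/
lemma exists_dual_gap_bound (z : Vec (Fin nb ⊕ Fin n)) : ∃ a : ℝ, 0 ≤ a ∧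
    ∀ x, ∀ zs ∈ S.Omega x,
      S.dualReal x z - S.dualReal x zs ≤ a * (1 + ‖x - S.x0‖) ^ 2 := by
  have hτ := hS.tau_pos
  have hL := hS.Lf_pos
  set p := ‖lin S.M.transpose z + gradient S.f0 S.x0‖
  set q := |(conj S.gbar (fstBlock z)).toReal - ⟪fstBlock z, S.y0⟫ + S.gbar S.y0|
  have hp : 0 ≤ p := norm_nonneg _
  have hq : 0 ≤ q := abs_nonneg _
  refine ⟨1 / (2 * S.tau) * (p + 3 * S.Lf) ^ 2 + q, by positivity, fun x zs hzs => ?_⟩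
  set N := ‖x - S.x0‖
  have hN : 0 ≤ N := norm_nonneg _
  refine (hS.dualReal_sub_le hzs z).trans ?_
  rw [add_mul]
  refine add_le_add ?_ ((le_abs_self _).trans ?_)
  · rw [mul_assoc, ← mul_pow]
    have h1 : ‖S.shifted x z + S.tau • S.x0‖ ≤ p + 3 * S.Lf * N :=
      hS.norm_gradient_sub_le x (lin S.M.transpose z)
    have h2 : p + 3 * S.Lf * N ≤ (p + 3 * S.Lf) * (1 + N) := by
      have := mul_nonneg hp hN
      nlinarith
    have h3 := h1.trans h2
    gcongr
  · exact le_mul_of_one_le_right hq (one_le_pow₀ (by linarith))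

/-- The exponent `8`: iterates at distance `O(ε⁻²)` give gaps `O(ε⁻⁴)`, and division by `δ²`, of
order at least `ε⁴`, contributes the rest. -/
lemma exists_loopCount_bound {ρ : ℝ} (hρ : 0 < ρ) (hg : ∀ x, S.HasGrowth ρ x) :
    ∃ P : ℝ, 0 < P ∧ ∀ ε : ℝ, 0 < ε → ε ≤ 1 → ∀ k < S.Kbar ε,
      S.loopCount ρ (S.deltaBar ε) (S.xIter (fun _ => ρ) (S.deltaBar ε) k) ≤
        ⌈Real.logb 2 (P / ε ^ 8)⌉₊ + 1 := by
  obtain ⟨zh, hzh, hzh'⟩ : ∃ zh ∈ S.dualDom, S.zini ∈ S.dualDom → zh = S.zini := by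
    by_cases h : S.zini ∈ S.dualDom
    · exact ⟨_, h, fun _ => rfl⟩
    · obtain ⟨zh, hzh⟩ := hS.dualDom_nonempty
      exact ⟨zh, hzh, fun h' => absurd h' h⟩
  obtain ⟨a, ha, hgap⟩ := hS.exists_dual_gap_bound zh
  obtain ⟨c, hc, hiter⟩ := hS.exists_iterate_bound
  have hδ1 := hS.deltaBar_pos one_pos
  set P₁ := 2 * ‖S.zini - zh‖ ^ 2 + 4 / ρ * (a * (1 + c) ^ 2) + 1 with hP₁
  have hP₁0 : 0 < P₁ := by positivity
  refine ⟨P₁ / S.deltaBar 1 ^ 2, by positivity, fun ε hε hε1 k hk => ?_⟩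
  have hδ := hS.deltaBar_pos hε
  obtain ⟨zs, hzs⟩ := hS.Omega_nonempty (S.xIter (fun _ => ρ) (S.deltaBar ε) k)
  refine (hS.loopCount_le hρ hδ (hg _) hzh hzh' hzs le_rfl).trans ?_
  refine Nat.succ_le_succ (ceil_logb_mono ?_ ?_)
  · have := sub_nonneg.2 ((hS.mem_Omega_iff.1 hzs).2 _ hzh)
    positivity
  have hN := hiter (fun _ => ρ) ε hε hε1 (fun _ => hρ) hg k hk
  have h1 : 1 + ‖S.xIter (fun _ => ρ) (S.deltaBar ε) k - S.x0‖ ≤ (1 + c) / ε ^ 2 := by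
    rw [add_div]
    refine add_le_add ?_ hN
    rw [le_div_iff₀ (by positivity)]; nlinarith
  have h2 := (hgap _ zs hzs).trans (mul_le_mul_of_nonneg_left
    (pow_le_pow_left₀ (by positivity) h1 2) ha)
  have h3 := hS.deltaBar_ge hε hε1
  have hε4 : 1 ≤ 1 / ε ^ 4 := by
    rw [le_div_iff₀ (by positivity), one_mul]; exact pow_le_one₀ hε.le hε1
  have h5 : 2 * ‖S.zini - zh‖ ^ 2 + 4 / ρ * (S.dualReal
      (S.xIter (fun _ => ρ) (S.deltaBar ε) k) zh
      - S.dualReal (S.xIter (fun _ => ρ) (S.deltaBar ε) k) zs) ≤ P₁ / ε ^ 4 := by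
    calc _ ≤ 2 * ‖S.zini - zh‖ ^ 2 * (1 / ε ^ 4)
          + 4 / ρ * (a * ((1 + c) / ε ^ 2) ^ 2) := by
          refine add_le_add (le_mul_of_one_le_right (by positivity) hε4) ?_
          gcongr
      _ = (2 * ‖S.zini - zh‖ ^ 2 + 4 / ρ * (a * (1 + c) ^ 2)) / ε ^ 4 := by
          field_simp
      _ ≤ P₁ / ε ^ 4 := by
          exact div_le_div_of_nonneg_right (by rw [hP₁]; linarith) (by positivity)
  calc _ ≤ P₁ / ε ^ 4 / (S.deltaBar 1 * ε ^ 2) ^ 2 := by gcongr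
    _ = P₁ / S.deltaBar 1 ^ 2 / ε ^ 8 := by field_simp

lemma complexity_of_growth {ρ s : ℝ} (hρ : 0 < ρ) (hg : ∀ x, S.HasGrowth ρ x) (hs : 1 ≤ s)
    (hLs : S.LD / ρ ≤ s ^ 2) : ∃ ε₀ : ℝ, 0 < ε₀ ∧ ∀ ε : ℝ, 0 < ε → ε < ε₀ →
      (S.totalSteps (fun _ => ρ) (S.deltaBar ε) (S.Kbar ε) : ℝ) ≤
        19968 * (s * Real.log (S.Delta / ε) * (S.Lf * S.Delta / ε ^ 2)) := by
  have hL := hS.Lf_pos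
  have hD := hS.Delta_pos
  obtain ⟨P, hP, hcount⟩ := hS.exists_loopCount_bound hρ hg
  obtain ⟨ε₁, hε₁, hlog⟩ := exists_ceil_logb_le hP hD
  refine ⟨min ε₁ (min 1 (Real.sqrt (192 * S.Lf * S.Delta))), by positivity,
    fun ε hε hε0 => ?_⟩
  rw [lt_min_iff, lt_min_iff] at hε0
  obtain ⟨e1, e2, e3⟩ := hε0
  have h1 := hlog ε hε e1
  have hI0 : 0 ≤ 13 * Real.log (S.Delta / ε) := le_trans (by positivity) h1
  have hI : ∀ k < S.Kbar ε, (S.loopCount ρ (S.deltaBar ε)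
      (S.xIter (fun _ => ρ) (S.deltaBar ε) k) : ℝ) ≤ 13 * Real.log (S.Delta / ε) :=
    fun k hk => le_trans (by exact_mod_cast hcount ε hε e2.le k hk) h1
  have h2 := totalSteps_le (ρ := fun _ => ρ) (δ := S.deltaBar ε) (J := 4 * s) hI0 hI
    (fun k _ => hS.loopLength_le hs hLs)
  refine h2.trans ((mul_le_mul_of_nonneg_right (hS.Kbar_le_of_small hε e3.le)
    (by positivity)).trans_eq ?_)
  ring

/-! ### Full row rank -/

lemma one_le_condNumber (hM : S.StackedFullRowRank) : 1 ≤ condNumber S.M := by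
  have := hS.nonempty_rows
  rw [condNumber, Real.one_le_sqrt, one_le_div (lamMin_mem hM).1]
  exact lamMin_le_lamMax hM

lemma LD_div_muD (hM : S.StackedFullRowRank) : S.LD / S.muD ≤ condNumber S.M ^ 2 := by
  have := hS.nonempty_rows
  have h1 := (lamMin_mem hM).1
  have h2 := lamMax_pos hS.M_ne_zero
  rw [condNumber, Real.sq_sqrt (by positivity), LD, muD, div_div_div_cancel_right₀ hS.tau_pos.ne']

section Polyhedral

variable {m : ℕ} {C : Matrix (Fin m) (Fin nb) ℝ} {c : Vec (Fin m)} {θ : ℝ}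

/-! ### Zero offsets -/

lemma LD_div_inv (θ : ℝ) : S.LD / (θ ^ 2 * S.tau)⁻¹ = lamMax S.M * θ ^ 2 := by
  have hτ := hS.tau_pos
  rw [LD]; field_simp

/-- For `z` in the domain but not optimal, `dist ≤ θ‖Mᵀ(z - zs)‖ ≤ θ √lamMax · dist` with positive
distance. This is what allows the ceiling in the loop length to be absorbed. -/
lemma one_le_of_notMem (hC : S.Polyhedral C c) (hθ : S.IsHoffmanSmall C c θ)
    (hz : z ∈ S.dualDom) (hzΩ : z ∉ S.Omega x) : 1 ≤ lamMax S.M * θ ^ 2 := by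
  obtain ⟨zs, hzs, hd⟩ := hS.exists_dist_eq x z
  have h1 := hS.infDist_le_of_hoffmanSmall hC hθ hz hzs
  have h2 := hS.infDist_pos hzΩ
  rw [← hd] at h1 h2
  have h3 := pow_le_pow_left₀ h2.le h1 2
  rw [mul_pow] at h3
  have h4 := mul_le_mul_of_nonneg_left (norm_lin_transpose_sq_le S.M (z - zs)) (sq_nonneg θ)
  have h5 : 1 * ‖z - zs‖ ^ 2 ≤ lamMax S.M * θ ^ 2 * ‖z - zs‖ ^ 2 := by linarith
  exact le_of_mul_le_mul_right h5 (by positivity)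

lemma loopCount_le_one {ρ δ : ℝ} (hρ : 0 < ρ) (hδ : 0 < δ) (h : S.dualDom ⊆ S.Omega x) :
    S.loopCount ρ δ x ≤ 1 := by
  by_cases hini : S.zini ∈ S.dualDom
  · rw [loopCount, if_pos (dual_lt_top_iff.2 hini), hS.gap_eq (h hini) hini]
    -- The gap is zero, and `Real.logb 2 0 = 0` gives no loops.
    simp
  · rw [loopCount, if_neg (fun h => hini (dual_lt_top_iff.1 h))]
    obtain ⟨zs, hzs⟩ := hS.Omega_nonempty x
    refine Nat.sInf_le (hS.accept_of_infDist_le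
      (hS.loop_dist_bound hρ S.zini hzs).1 ?_)
    exact (Metric.infDist_zero_of_mem (h (hS.loop_dist_bound hρ S.zini hzs).1)).trans_le hδ.le

/-- Here `s` may be small, so the loop length is not an absolute multiple of it. At most one loop
runs per outer iteration, and for small `ε` the factor `log(Δ/ε)` exceeds the fixed ratio `J/s`. -/
lemma complexity_of_trivial {ρ s : ℝ} (hρ : 0 < ρ) (hs : 0 < s)
    (h : ∀ x, S.dualDom ⊆ S.Omega x) : ∃ ε₀ : ℝ, 0 < ε₀ ∧ ∀ ε : ℝ, 0 < ε → ε < ε₀ →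
      (S.totalSteps (fun _ => ρ) (S.deltaBar ε) (S.Kbar ε) : ℝ) ≤
        19968 * (s * Real.log (S.Delta / ε) * (S.Lf * S.Delta / ε ^ 2)) := by
  have hL := hS.Lf_pos
  have hD := hS.Delta_pos
  obtain ⟨J, hJ⟩ : ∃ J : ℝ, J = S.loopLength ρ := ⟨_, rfl⟩
  have hJ0 : 0 ≤ J := hJ ▸ Nat.cast_nonneg _
  refine ⟨min (S.Delta * Real.exp (-(J / s))) (Real.sqrt (192 * S.Lf * S.Delta)),
    by positivity, fun ε hε hε0 => ?_⟩
  rw [lt_min_iff] at hε0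
  obtain ⟨e1, e2⟩ := hε0
  have h1 : J ≤ s * Real.log (S.Delta / ε) := by
    rw [← div_le_iff₀' hs]
    refine (Real.lt_log_iff_exp_lt (by positivity)).2 ?_ |>.le
    rw [Real.exp_neg, ← div_eq_mul_inv, lt_div_iff₀ (Real.exp_pos _)] at e1
    rw [lt_div_iff₀ hε]
    linarith
  have h2 := totalSteps_le (S := S) (ρ := fun _ => ρ) (δ := S.deltaBar ε) (J := J)
    (K := S.Kbar ε) zero_le_one
    (fun k _ => by exact_mod_cast hS.loopCount_le_one hρ (hS.deltaBar_pos hε) (h _))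
    (fun k _ => hJ.ge)
  have h3 : 0 ≤ S.Lf * S.Delta / ε ^ 2 := by positivity
  rw [one_mul] at h2
  have h4 := mul_le_mul (hS.Kbar_le_of_small hε e2.le) h1 hJ0 (by positivity)
  refine h2.trans (h4.trans ?_)
  have h5 : 0 ≤ s * Real.log (S.Delta / ε) * (S.Lf * S.Delta / ε ^ 2) :=
    mul_nonneg (hJ0.trans h1) h3
  linarith

lemma complexity_of_hoffmanSmall (hC : S.Polyhedral C c) (hbb : S.bbar = 0) (hb : S.b = 0)
    (hθ : S.IsHoffmanSmall C c θ) : ∃ ε₀ : ℝ, 0 < ε₀ ∧ ∀ ε : ℝ, 0 < ε → ε < ε₀ →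
      (S.totalSteps (S.rho θ) (S.deltaBar ε) (S.Kbar ε) : ℝ) ≤
        19968 * (Real.sqrt (lamMax S.M * θ ^ 2) * Real.log (S.Delta / ε)
          * (S.Lf * S.Delta / ε ^ 2)) := by
  have hθ0 := hS.hoffmanSmall_pos hθ
  have hτ := hS.tau_pos
  have hlam := lamMax_pos hS.M_ne_zero
  have hrho : S.rho θ = fun _ => (θ ^ 2 * S.tau)⁻¹ := funext fun x => if_pos ⟨hbb, hb⟩
  have hg := hS.hasGrowth_rho_of_hoffmanSmall hC hθ hbb hb
  rw [hrho] at hg ⊢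
  by_cases h : ∀ x, S.dualDom ⊆ S.Omega x
  · exact hS.complexity_of_trivial (by positivity) (by positivity) h
  · push Not at h
    obtain ⟨x, h⟩ := h
    obtain ⟨z, hz, hzΩ⟩ := Set.not_subset.1 h
    have h1 := hS.one_le_of_notMem hC hθ hz hzΩ
    refine hS.complexity_of_growth (by positivity) hg (Real.one_le_sqrt.2 h1) ?_
    rw [hS.LD_div_inv, Real.sq_sqrt (by positivity)]

/-! ### General offsets -/

omit hS in
lemma zini_mem (h : conj S.gbar S.y0 < ⊤) : S.zini ∈ S.dualDom := h

/-- `B6` comes from the quadratic gap bound on the ball. Growth then bounds `‖Mᵀ(zini - zs)‖` by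
`√(2τ B6)`, and hence `τ‖ν‖` by `W`. -/
lemma exists_isBound (hini : S.zini ∈ S.dualDom) (R : ℝ) :
    ∃ B5 B6 : ℝ, 0 < B6 ∧ ∀ x, ‖x‖ ≤ R → S.IsBound B5 B6 x := by
  have hτ := hS.tau_pos
  have hL := hS.Lf_pos
  obtain ⟨a, ha, hgap⟩ := hS.exists_dual_gap_bound S.zini
  set N := |R| + ‖S.x0‖
  set B6 := a * (1 + N) ^ 2 + 1 with hB6
  have hB60 : 0 < B6 := by positivity
  set W := ‖lin S.M.transpose S.zini + gradient S.f0 S.x0‖ + 3 * S.Lf * N + S.tau * ‖S.x0‖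
    + Real.sqrt (2 * S.tau * B6)
  refine ⟨(W / S.tau) ^ 2, B6, hB60, fun x hx => ?_⟩
  obtain ⟨zs, hzs⟩ := hS.Omega_nonempty x
  have hN : ‖x - S.x0‖ ≤ N :=
    (norm_sub_le _ _).trans (add_le_add (hx.trans (le_abs_self R)) le_rfl)
  have h1 : S.dualReal x S.zini - S.dualReal x zs ≤ B6 := by
    refine (hgap x zs hzs).trans ?_
    have : a * (1 + ‖x - S.x0‖) ^ 2 ≤ a * (1 + N) ^ 2 := by gcongr
    linarith
  refine ⟨?_, ?_⟩
  · refine pow_le_pow_left₀ (norm_nonneg _) ?_ 2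
    rw [le_div_iff₀ hτ]
    have h2 : ‖S.nu x‖ * S.tau = ‖S.shifted x zs‖ := by
      rw [← hS.tau_smul_nu hzs, norm_smul, Real.norm_of_nonneg hτ.le, mul_comm]
    rw [h2]
    have h3 : ‖S.shifted x S.zini - S.shifted x zs‖ ≤ Real.sqrt (2 * S.tau * B6) := by
      refine Real.le_sqrt_of_sq_le ?_
      have h4 := hS.growth_norm hzs hini
      have h5 : 1 / (2 * S.tau) * ‖lin S.M.transpose (S.zini - zs)‖ ^ 2 ≤ B6 := by linarith
      rw [one_div, inv_mul_le_iff₀ (by positivity)] at h5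
      rwa [shifted_sub]
    have h6 : ‖S.shifted x S.zini + S.tau • S.x0‖ ≤
        ‖lin S.M.transpose S.zini + gradient S.f0 S.x0‖ + 3 * S.Lf * N := by
      refine (hS.norm_gradient_sub_le x (lin S.M.transpose S.zini)).trans ?_
      gcongr
    have h7 : S.shifted x zs = (S.shifted x S.zini + S.tau • S.x0) - S.tau • S.x0
        - (S.shifted x S.zini - S.shifted x zs) := by abel
    rw [h7]
    refine (norm_sub_le _ _).trans (add_le_add ((norm_sub_le _ _).trans (add_le_add h6 ?_)) h3)
    rw [norm_smul, Real.norm_of_nonneg hτ.le]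
  · rw [hS.dualMin_eq hzs, dual_eq_coe hini, ← EReal.coe_sub]
    exact_mod_cast h1

lemma gap_le_of_isBound {B5 B6 : ℝ} (hini : S.zini ∈ S.dualDom) (h : S.IsBound B5 B6 x) :
    0 ≤ S.gap x ∧ S.gap x ≤ B6 := by
  obtain ⟨zs, hzs⟩ := hS.Omega_nonempty x
  have h1 := h.2
  rw [hS.dualMin_eq hzs, dual_eq_coe hini, ← EReal.coe_sub] at h1
  rw [hS.gap_eq hzs hini]
  exact ⟨sub_nonneg.2 ((hS.mem_Omega_iff.1 hzs).2 _ hini), by exact_mod_cast h1⟩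

lemma one_div_rho_le {B5 B6 : ℝ} (hini : S.zini ∈ S.dualDom) (h : S.IsBound B5 B6 x) :
    1 / S.rho θ x ≤ θ ^ 2 * (S.tau + B6 + 2 * S.tau * B5) := by
  have hτ := hS.tau_pos
  obtain ⟨h1, h2⟩ := hS.gap_le_of_isBound hini h
  have h3 := h.1
  have h4 : 0 ≤ B5 := (sq_nonneg _).trans h3
  have h5 : 0 ≤ B6 := h1.trans h2
  rw [rho]
  split_ifs
  · rw [one_div, inv_inv]
    have : 0 ≤ 2 * S.tau * B5 := by positivity
    gcongr
    linarith
  · rw [one_div, inv_inv]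
    gcongr

lemma complexity_of_hoffman (hC : S.Polyhedral C c) (hθ : S.IsHoffman C c θ)
    (hini : S.zini ∈ S.dualDom) {B5 B6 : ℝ} (hB6 : 0 < B6) :
    ∃ ε₀ : ℝ, 0 < ε₀ ∧ ∀ ε : ℝ, 0 < ε → ε < ε₀ →
      (∀ k, S.IsBound B5 B6 (S.xIter (S.rho θ) (S.deltaBar ε) k)) →
      (S.totalSteps (S.rho θ) (S.deltaBar ε) (S.Kbar ε) : ℝ) ≤
        19968 * (max 1 (Real.sqrt (lamMax S.M * θ ^ 2 * (1 + B6 / S.tau + 2 * B5)))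
          * Real.log (B6 / ε) * (S.Lf * S.Delta / ε ^ 2)) := by
  have hL := hS.Lf_pos
  have hD := hS.Delta_pos
  have hτ := hS.tau_pos
  have hθ0 := hS.hoffman_pos hθ
  have hlam := lamMax_pos hS.M_ne_zero
  have hδ1 := hS.deltaBar_pos one_pos
  -- The threshold for `ε` is fixed before any bound on the iterates is known, and only such a bound
  -- gives `0 ≤ B5`; hence the absolute value.
  set P₁ := 4 * (θ ^ 2 * (S.tau + B6 + 2 * S.tau * |B5|)) * B6 with hP₁
  have hP₁0 : 0 < P₁ := by positivity
  obtain ⟨ε₁, hε₁, hlog⟩ := exists_ceil_logb_le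
    (by positivity : 0 < P₁ / S.deltaBar 1 ^ 2) hB6
  refine ⟨min ε₁ (min 1 (Real.sqrt (192 * S.Lf * S.Delta))), by positivity,
    fun ε hε hε0 hbound => ?_⟩
  rw [lt_min_iff, lt_min_iff] at hε0
  obtain ⟨e1, e2, e3⟩ := hε0
  have hδ := hS.deltaBar_pos hε
  have hδge := hS.deltaBar_ge hε e2.le
  have h1 := hlog ε hε e1
  set s := max 1 (Real.sqrt (lamMax S.M * θ ^ 2 * (1 + B6 / S.tau + 2 * B5)))
  have hB5 : 0 ≤ B5 := (sq_nonneg _).trans (hbound 0).1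
  have hI0 : 0 ≤ 13 * Real.log (B6 / ε) := le_trans (by positivity) h1
  set x := S.xIter (S.rho θ) (S.deltaBar ε)
  have hI : ∀ k < S.Kbar ε, (S.loopCount (S.rho θ (x k)) (S.deltaBar ε) (x k) : ℝ) ≤
      13 * Real.log (B6 / ε) := by
    intro k _
    refine le_trans ?_ h1
    obtain ⟨zs, hzs⟩ := hS.Omega_nonempty (x k)
    have hρ := hS.rho_pos hθ0 (Or.inr hini) (x k)
    obtain ⟨g0, g1⟩ := hS.gap_le_of_isBound hini (hbound k)
    have hP : 2 * ‖S.zini - S.zini‖ ^ 2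
        + 4 / S.rho θ (x k) * (S.dualReal (x k) S.zini - S.dualReal (x k) zs) ≤ P₁ := by
      rw [sub_self, norm_zero, zero_pow two_ne_zero, mul_zero, zero_add, ← hS.gap_eq hzs hini,
        hP₁, abs_of_nonneg hB5, ← mul_one_div]
      have := hS.one_div_rho_le (θ := θ) hini (hbound k)
      gcongr
    have h2 := hS.loopCount_le hρ hδ (hS.hasGrowth_rho_of_hoffman hC hθ hini (x k)) hini
      (fun _ => rfl) hzs hP
    -- The power `ε⁴` would do, since the gap is bounded by `B6`; it is weakened to `ε⁸` to fit
    -- `exists_ceil_logb_le`.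
    have h3 : P₁ / S.deltaBar ε ^ 2 ≤ P₁ / S.deltaBar 1 ^ 2 / ε ^ 8 := by
      calc _ ≤ P₁ / (S.deltaBar 1 * ε ^ 2) ^ 2 := by gcongr
        _ = P₁ / S.deltaBar 1 ^ 2 / ε ^ 4 := by field_simp
        _ ≤ _ := by
          refine div_le_div_of_nonneg_left (by positivity) (by positivity) ?_
          exact pow_le_pow_of_le_one hε.le e2.le (by norm_num)
    have h4 := h2.trans (Nat.succ_le_succ (ceil_logb_mono (by positivity) h3))
    exact_mod_cast h4
  have hJ : ∀ k < S.Kbar ε, (S.loopLength (S.rho θ (x k)) : ℝ) ≤ 4 * s := by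
    intro k _
    refine hS.loopLength_le (le_max_left _ _) ?_
    have h2 := hS.one_div_rho_le (θ := θ) hini (hbound k)
    have h3 : S.LD / S.rho θ (x k) ≤ lamMax S.M * θ ^ 2 * (1 + B6 / S.tau + 2 * B5) := by
      rw [← mul_one_div]
      refine (mul_le_mul_of_nonneg_left h2 hS.LD_pos.le).trans_eq ?_
      rw [LD]; field_simp
    refine h3.trans ?_
    rw [← Real.sq_sqrt (by positivity : 0 ≤ lamMax S.M * θ ^ 2 * (1 + B6 / S.tau + 2 * B5))]
    exact pow_le_pow_left₀ (Real.sqrt_nonneg _) (le_max_right _ _) 2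
  have hs0 : 0 ≤ s := zero_le_one.trans (le_max_left _ _)
  refine (totalSteps_le hI0 hI hJ).trans ((mul_le_mul_of_nonneg_right
    (hS.Kbar_le_of_small hε e3.le) (by positivity)).trans_eq ?_)
  ring

end Polyhedral

end StandingAssumptions
end Setup

end IPG

end

open IPG in
theorem mainTheorem5 : ∃ Cst : ℝ, 0 < Cst ∧
    ∀ (d n nb : ℕ) (S : Setup d n nb),
      S.ProblemAssumptions → S.LipschitzAssumptions → S.InputAssumptions →
      S.M ≠ 0 → 0 < S.Delta →
      -- (a) the stacked matrix has full row rank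
      (S.StackedFullRowRank →
        (∀ ε : ℝ, 0 < ε → S.FindsNearStationary (fun _ => S.muD) ε) ∧
        ∃ ε₀ : ℝ, 0 < ε₀ ∧ ∀ ε : ℝ, 0 < ε → ε < ε₀ →
          (S.totalSteps (fun _ => S.muD) (S.deltaBar ε) (S.Kbar ε) : ℝ) ≤
            Cst * (condNumber S.M * Real.log (S.Delta / ε) * (S.Lf * S.Delta / ε ^ 2))) ∧
      -- (b) polyhedral case with zero offsets
      (∀ (m : ℕ) (C : Matrix (Fin m) (Fin nb) ℝ) (c : Vec (Fin m)) (θ : ℝ),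
        S.Polyhedral C c → S.bbar = 0 → S.b = 0 → S.IsHoffmanSmall C c θ →
        (∀ ε : ℝ, 0 < ε → S.FindsNearStationary (S.rho θ) ε) ∧
        ∃ ε₀ : ℝ, 0 < ε₀ ∧ ∀ ε : ℝ, 0 < ε → ε < ε₀ →
          (S.totalSteps (S.rho θ) (S.deltaBar ε) (S.Kbar ε) : ℝ) ≤
            Cst * (Real.sqrt (lamMax S.M * θ ^ 2) * Real.log (S.Delta / ε)
              * (S.Lf * S.Delta / ε ^ 2))) ∧
      -- (c) polyhedral case with bounded iterates
      (∀ (m : ℕ) (C : Matrix (Fin m) (Fin nb) ℝ) (c : Vec (Fin m)) (θ : ℝ),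
        S.Polyhedral C c → S.IsHoffman C c θ → conj S.gbar S.y0 < ⊤ →
        (∀ ε : ℝ, 0 < ε → S.FindsNearStationary (S.rho θ) ε) ∧
        (∀ R : ℝ, ∃ B5 B6 : ℝ, 0 < B6 ∧ ∀ ε : ℝ, 0 < ε →
          (∀ k, ‖S.xIter (S.rho θ) (S.deltaBar ε) k‖ ≤ R) →
          ∀ k, S.IsBound B5 B6 (S.xIter (S.rho θ) (S.deltaBar ε) k)) ∧
        (∀ B5 B6 : ℝ, 0 < B6 → ∃ ε₀ : ℝ, 0 < ε₀ ∧ ∀ ε : ℝ, 0 < ε → ε < ε₀ →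
          (∀ k, S.IsBound B5 B6 (S.xIter (S.rho θ) (S.deltaBar ε) k)) →
          (S.totalSteps (S.rho θ) (S.deltaBar ε) (S.Kbar ε) : ℝ) ≤
            Cst * (max 1 (Real.sqrt (lamMax S.M * θ ^ 2 * (1 + B6 / S.tau + 2 * B5)))
              * Real.log (B6 / ε) * (S.Lf * S.Delta / ε ^ 2)))) := by
  refine ⟨19968, by norm_num, fun d n nb S hP hLip hIn hM hD => ?_⟩
  have hS : S.StandingAssumptions := ⟨hP, hLip, hIn, hM, hD⟩
  refine ⟨fun hrank => ⟨fun ε hε => ?_, ?_⟩, fun m C c θ hC hbb hb hθ => ⟨fun ε hε => ?_, ?_⟩,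
    fun m C c θ hC hθ hy => ?_⟩
  · exact hS.findsNearStationary (fun _ => hS.muD_pos hrank) (hS.hasGrowth_muD hrank) hε
  · exact hS.complexity_of_growth (hS.muD_pos hrank) (hS.hasGrowth_muD hrank)
      (hS.one_le_condNumber hrank) (hS.LD_div_muD hrank)
  · exact hS.findsNearStationary (hS.rho_pos (hS.hoffmanSmall_pos hθ) (Or.inl ⟨hbb, hb⟩))
      (hS.hasGrowth_rho_of_hoffmanSmall hC hθ hbb hb) hε
  · exact hS.complexity_of_hoffmanSmall hC hbb hb hθ
  · have hini : S.zini ∈ S.dualDom := Setup.StandingAssumptions.zini_mem hy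
    refine ⟨fun ε hε => hS.findsNearStationary (hS.rho_pos (hS.hoffman_pos hθ) (Or.inr hini))
      (hS.hasGrowth_rho_of_hoffman hC hθ hini) hε, fun R => ?_,
      fun B5 B6 hB6 => hS.complexity_of_hoffman hC hθ hini hB6⟩
    obtain ⟨B5, B6, hB6, h⟩ := hS.exists_isBound hini R
    exact ⟨B5, B6, hB6, fun ε _ hR k => h _ (hR k)⟩
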